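/- For an integer $M\ge 1$ let $V_{\sqrt{M}\mathbb Z}=\bigoplus_{m\in\mathbb Z}F_{m\sqrt M}$, where $F_\mu$ is the Fock module with highest weight vector $|\mu\rangle$, $a_0|\mu\rangle=\mu|\mu\rangle$, over the Heisenberg algebra $[a_n,a_m]=n\,\delta_{n+m,0}$. Let $$V_{\sqrt M}(z)=e^{\sqrt M q}\,z^{\sqrt M a_0}\exp\Big(-\sqrt M\sum_{n<0}\frac{a_n}{n}z^{-n}\Big)\exp\Big(-\sqrt M\sum_{n>0}\frac{a_n}{n}z^{-n}\Big),$$ where $e^{\sqrt M q}$ maps $|m\sqrt M\rangle$ to $|(m+1)\sqrt M\rangle$ and commutes with all $a_n$, $n\neq0$. Define modes by $V_{\sqrt{2N}}(z)=\sum_n e_n z^{-n-N}$ and $V_{\sqrt{2N+1}}(z)=\sum_n\theta_n z^{-n}$. The $e_n$ commute with each other and the $\theta_n$ anticommute with each other (in particular $\theta_n^2=0$), so that the polynomial algebra $\mathbb C[e_i\mid i\in\mathbb Z]$, respectively the exterior algebra $\mathbb C\{\theta_i\mid i\in\mathbb Z\}$, acts. For $j\in\mathbb Z$ let $W_j^{\sqrt{2N}}=\mathbb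 C[e_i\mid i\in\mathbb Z]\,|j\sqrt{2N}\rangle$ and $W_j^{\sqrt{2N+1}}=\mathbb C\{\theta_i\mid i\in\mathbb Z\}\,|j\sqrt{2N+1}\rangle$. A Fibonacci-$l$ polynomial (respectively anti-symmetric Fibonacci-$l$ polynomial) is a linear combination of monomials $x_{j_1}x_{j_2}\cdots x_{j_k}$, $k\ge0$, with $j_{r}-j_{r-1}>l$ for $2\le r\le k$, in commuting (respectively anticommuting) variables; these spaces are denoted $\mathbb C^F_l[x_i]$ and $\mathbb C^F_l\{x_i\}$. Finally, $\operatorname{ch}W=\operatorname{Tr}_W z^{a_0/\sqrt M}q^{L_0}$, where $L_0=\frac12a_0^2+\sum_{n>0}a_{-n}a_n-\lambda a_0$ with $\lambda=0$ if $M=2N$ and $\lambda=\frac{\sqrt{M}}2$ if $M=2N+1$, and $(q)_n=\prod_{k=1}^n(1-q^k)$. 1. For all $N\ge1$ and $j\in\mathbb Z$ the map $f\mapsto f\,|j\sqrt{2N}\rangle$ is a linear isomorphism $$\mathbb C^F_{2N-1}[e_i\mid i\le -2Nj-N]\;\xrightarrow{\ \sim\ }\;W_j^{\sqrt{2N}},$$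 and $W_j^{\sqrt{2N}}$ is the direct sum of its joint eigenspaces for $(a_0,L_0)$, which are finite dimensional, with $$\operatorname{ch}W_j^{\sqrt{2N}}=\sum_{m\ge j}\frac{z^m q^{Nm^2}}{(q)_{m-j}}.$$ 2. For all $N\ge0$ and $j\in\mathbb Z$ the map $f\mapsto f\,|j\sqrt{2N+1}\rangle$ is a linear isomorphism $$\mathbb C^F_{2N}\{\theta_i\mid i\le -j(2N+1)\}\;\xrightarrow{\ \sim\ }\;W_j^{\sqrt{2N+1}},$$ and $W_j^{\sqrt{2N+1}}$ is the direct sum of its joint eigenspaces for $(a_0,L_0)$, which are finite dimensional, with $$\operatorname{ch}W_j^{\sqrt{2N+1}}=\sum_{m\ge j}\frac{z^m q^{(2N+1)m(m-1)/2}}{(q)_{m-j}}.$$ -/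

import Mathlib

/-- The underlying space `⨁_{m ∈ ℤ} F_{m√M}` of the lattice vertex superalgebra `V_{√M ℤ}`.  Every
Fock module is realised on `ℂ[x₁, x₂, …]`, where `x_n` stands for the creation operator `a_{-n}`;
`Finsupp.single m P` is the vector `P(a_{-1}, a_{-2}, …)|m√M⟩`. -/
abbrev LatticeSpace : Type := ℤ →₀ MvPolynomial ℕ+ ℂ

noncomputable section

namespace LatticeVOA

/-- The highest weight vector `|j√M⟩`. -/
def vac (j : ℤ) : LatticeSpace := Finsupp.single j 1

/-- The number `√M` as a complex number. -/
def root (M : ℕ) : ℂ := ((Real.sqrt M : ℝ) : ℂ)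

/-- The Heisenberg operators `a_n`, `n ∈ ℤ`, with `[a_n, a_m] = n δ_{n+m,0}`: on every `F_{m√M}`,
`a_0` is the scalar `m√M`, `a_n = n ∂/∂x_n` and `a_{-n}` is multiplication by `x_n` for `n > 0`. -/
def a (M : ℕ) : ℤ → Module.End ℂ LatticeSpace
  | Int.ofNat 0 => Finsupp.lsum ℂ fun m : ℤ => ((m : ℂ) * root M) • Finsupp.lsingle m
  | Int.ofNat (n + 1) => ((n : ℂ) + 1) •
      Finsupp.mapRange.linearMap (MvPolynomial.pderiv n.succPNat).toLinearMap
  | Int.negSucc n =>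
      Finsupp.mapRange.linearMap (LinearMap.mulLeft ℂ (MvPolynomial.X n.succPNat))

/-- The operator `e^{√M q}`: it shifts `F_{m√M}` to `F_{(m+1)√M}` and commutes with `a_n`, `n ≠ 0`. -/
def shift : Module.End ℂ LatticeSpace := Finsupp.lmapDomain _ ℂ (fun m : ℤ => m + 1)

/-- The coefficient of `X ^ p` in `exp A = ∑ₖ Aᵏ / k!`, for a series `A` of operators without
constant term (so that only the powers `k ≤ p` contribute). -/
def expCoeff (A : PowerSeries (Module.End ℂ LatticeSpace)) (p : ℕ) :
    Module.End ℂ LatticeSpace :=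
  ∑ k ∈ Finset.range (p + 1), ((k.factorial : ℂ)⁻¹) • PowerSeries.coeff p (A ^ k)

/-- `-√M ∑_{n<0} (a_n / n) z^{-n} = √M ∑_{k>0} (a_{-k} / k) z^k`, as a power series in `z`. -/
def creationSeries (M : ℕ) : PowerSeries (Module.End ℂ LatticeSpace) :=
  PowerSeries.mk fun k => if k = 0 then 0 else (root M / (k : ℂ)) • a M (-(k : ℤ))

/-- `-√M ∑_{n>0} (a_n / n) z^{-n}`, as a power series in `z⁻¹`. -/
def annihilationSeries (M : ℕ) : PowerSeries (Module.End ℂ LatticeSpace) :=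
  PowerSeries.mk fun k => if k = 0 then 0 else (-(root M) / (k : ℂ)) • a M (k : ℤ)

/-- The coefficient of `z ^ p` (`p ∈ ℤ`) in `exp (-√M ∑_{n<0} (a_n / n) z^{-n})`. -/
def creationExp (M : ℕ) (p : ℤ) : Module.End ℂ LatticeSpace :=
  if 0 ≤ p then expCoeff (creationSeries M) p.toNat else 0

/-- The coefficient of `z ^ (-r)` in `exp (-√M ∑_{n>0} (a_n / n) z^{-n})`. -/
def annihilationExp (M : ℕ) (r : ℕ) : Module.End ℂ LatticeSpace :=
  expCoeff (annihilationSeries M) r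

/-- The sum `∑_r T_r` of a family of operators such that every vector is killed by all but finitely
many of them. -/
def locallyFiniteSum (T : ℕ → Module.End ℂ LatticeSpace)
    (hT : ∀ v, {r | T r v ≠ 0}.Finite) : Module.End ℂ LatticeSpace where
  toFun v := ∑ᶠ r, T r v
  map_add' v w := by
    simp only [map_add]
    exact finsum_add_distrib (hT v) (hT w)
  map_smul' c v := by
    simp only [map_smul, RingHom.id_apply]
    exact (smul_finsum' c (hT v)).symm

/-- Vectors all of whose monomials `∏ x_n ^ {k_n}` have energy `∑ n k_n ≤ d`. -/
def energyLE (d : ℤ) : Submodule ℂ LatticeSpace where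
  carrier := {v | ∀ m s, MvPolynomial.coeff s (v m) ≠ 0 →
    ((Finsupp.weight (fun n : ℕ+ => (n : ℕ)) s : ℕ) : ℤ) ≤ d}
  zero_mem' := by intro m s h; simp at h
  add_mem' := by
    intro v w hv hw m s h
    by_cases h1 : MvPolynomial.coeff s (v m) = 0
    · refine hw m s fun h2 => h ?_
      simp [h1, h2]
    · exact hv m s h1
  smul_mem' := by
    intro c v hv m s h
    refine hv m s fun h2 => h ?_
    simp [h2]

theorem exists_energyLE (v : LatticeSpace) : ∃ d, v ∈ energyLE d := by
  induction v using Finsupp.induction_linear with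
  | zero => exact ⟨0, zero_mem _⟩
  | add v w hv hw =>
    obtain ⟨d, hd⟩ := hv
    obtain ⟨d', hd'⟩ := hw
    refine ⟨max d d', add_mem (fun m s h => ?_) (fun m s h => ?_)⟩
    · exact (hd m s h).trans (le_max_left _ _)
    · exact (hd' m s h).trans (le_max_right _ _)
  | single m P =>
    refine ⟨((MvPolynomial.weightedTotalDegree (fun n : ℕ+ => (n : ℕ)) P : ℕ) : ℤ), ?_⟩
    intro m' s h
    rw [Finsupp.single_apply] at h
    split_ifs at h with hm
    · exact_mod_cast MvPolynomial.le_weightedTotalDegree _ (MvPolynomial.mem_support_iff.mpr h)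
    · simp at h

theorem eq_zero_of_mem_energyLE {d : ℤ} (hd : d < 0) {v : LatticeSpace} (hv : v ∈ energyLE d) :
    v = 0 := by
  ext m s
  by_contra h
  have := hv m s h
  omega

theorem a_mem_energyLE (M : ℕ) (n : ℕ) (hn : n ≠ 0) {d : ℤ} {v : LatticeSpace}
    (hv : v ∈ energyLE d) : a M (n : ℤ) v ∈ energyLE (d - n) := by
  obtain ⟨n, rfl⟩ := Nat.exists_eq_succ_of_ne_zero hn
  have : a M ((n.succ : ℕ) : ℤ) = ((n : ℂ) + 1) •
      Finsupp.mapRange.linearMap (MvPolynomial.pderiv n.succPNat).toLinearMap := rfl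
  rw [this, LinearMap.smul_apply]
  refine Submodule.smul_mem _ _ fun m s h => ?_
  simp only [Finsupp.mapRange.linearMap_apply, Finsupp.mapRange_apply] at h
  have h' : MvPolynomial.coeff (s + Finsupp.single n.succPNat 1) (v m) ≠ 0 := by
    intro h0
    apply h
    change MvPolynomial.coeff s (MvPolynomial.pderiv n.succPNat (v m)) = 0
    rw [MvPolynomial.coeff_pderiv, h0, zero_mul]
  have := hv m _ h'
  rw [map_add, Finsupp.weight_single] at this
  simp at this ⊢
  omega

theorem annihilationSeries_pow_mem (M k r : ℕ) {d : ℤ} {v : LatticeSpace}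
    (hv : v ∈ energyLE d) :
    PowerSeries.coeff r (annihilationSeries M ^ k) v ∈ energyLE (d - r) := by
  induction k generalizing r d v with
  | zero =>
    rw [pow_zero, PowerSeries.coeff_one]
    split_ifs with h
    · subst h; simpa using hv
    · simp
  | succ k ih =>
    rw [pow_succ, PowerSeries.coeff_mul, LinearMap.sum_apply]
    refine Submodule.sum_mem _ fun p hp => ?_
    rw [Finset.HasAntidiagonal.mem_antidiagonal] at hp
    rw [Module.End.mul_apply]
    have h1 : PowerSeries.coeff p.2 (annihilationSeries M) v ∈ energyLE (d - p.2) := by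
      rw [annihilationSeries, PowerSeries.coeff_mk]
      split_ifs with h
      · simp
      · exact Submodule.smul_mem _ _ (a_mem_energyLE M _ h hv)
    have h2 := ih p.1 h1
    have e : d - (r : ℤ) = d - p.2 - p.1 := by rw [← hp]; push_cast; ring
    rwa [e]

theorem annihilationExp_finite (M : ℕ) (T : ℕ → Module.End ℂ LatticeSpace) (v : LatticeSpace) :
    {r | (T r * annihilationExp M r) v ≠ 0}.Finite := by
  obtain ⟨d, hd⟩ := exists_energyLE v
  refine (Set.finite_Iic d.toNat).subset fun r hr => ?_
  by_contra hlt
  simp only [Set.mem_Iic, not_le] at hlt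
  apply hr
  have : annihilationExp M r v = 0 := by
    rw [annihilationExp, expCoeff, LinearMap.sum_apply]
    refine Finset.sum_eq_zero fun k _ => ?_
    rw [LinearMap.smul_apply,
      eq_zero_of_mem_energyLE (by omega) (annihilationSeries_pow_mem M k r hd), smul_zero]
  rw [Module.End.mul_apply, this, map_zero]

theorem a_mul_a_finite (M : ℕ) (v : LatticeSpace) :
    {k : ℕ | (a M (-((k : ℤ) + 1)) * a M ((k : ℤ) + 1)) v ≠ 0}.Finite := by
  obtain ⟨d, hd⟩ := exists_energyLE v
  refine (Set.finite_Iic d.toNat).subset fun k hk => ?_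
  by_contra hlt
  simp only [Set.mem_Iic, not_le] at hlt
  apply hk
  have h := a_mem_energyLE M (k + 1) (Nat.succ_ne_zero k) hd
  have h0 := eq_zero_of_mem_energyLE (by push_cast; omega) h
  push_cast at h0
  rw [Module.End.mul_apply, h0, map_zero]

/-- The coefficient of `z ^ s` in the vertex operator
`V_{√M}(z) = e^{√M q} z^{√M a_0} exp(-√M ∑_{n<0} (a_n/n) z^{-n}) exp(-√M ∑_{n>0} (a_n/n) z^{-n})`.
On `F_{m√M}` the factor `z^{√M a_0}` is `z^{M m}`, so the exponents satisfy `M m + p - r = s`. -/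
def vertexCoeff (M : ℕ) (s : ℤ) : Module.End ℂ LatticeSpace :=
  Finsupp.lsum ℂ fun m : ℤ =>
    (locallyFiniteSum
      (fun r => (shift * creationExp M (s + r - M * m)) * annihilationExp M r)
      (annihilationExp_finite M _)) ∘ₗ Finsupp.lsingle m

/-- The modes in the even case: `V_{√(2N)}(z) = ∑ e_n z^{-n-N}`. -/
def e (N : ℕ) (n : ℤ) : Module.End ℂ LatticeSpace := vertexCoeff (2 * N) (-n - N)

/-- The modes in the odd case: `V_{√(2N+1)}(z) = ∑ θ_n z^{-n}`. -/
def θ (N : ℕ) (n : ℤ) : Module.End ℂ LatticeSpace := vertexCoeff (2 * N + 1) (-n)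

/-- The basic subspace generated from `|j√M⟩` by all polynomials in the given modes. -/
def basicSubspace (modes : ℤ → Module.End ℂ LatticeSpace) (j : ℤ) : Submodule ℂ LatticeSpace :=
  (Subalgebra.toSubmodule (Algebra.adjoin ℂ (Set.range modes))).map (LinearMap.applyₗ (vac j))

/-- The basic subspace `W_j^{√(2N)}`. -/
def Weven (N : ℕ) (j : ℤ) : Submodule ℂ LatticeSpace := basicSubspace (e N) j

/-- The basic subspace `W_j^{√(2N+1)}`. -/
def Wodd (N : ℕ) (j : ℤ) : Submodule ℂ LatticeSpace := basicSubspace (θ N) j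

/-- The index set of a Fibonacci-`l` monomial in the variables with index at most `b`: the
differences of distinct indices exceed `l`. -/
def IsFib (l : ℕ) (b : ℤ) (s : Finset ℤ) : Prop :=
  (∀ i ∈ s, i ≤ b) ∧ ∀ i ∈ s, ∀ j ∈ s, i < j → (l : ℤ) < j - i

/-- The space `ℂ^F_l[x_i | i ≤ b]` of Fibonacci-`l` polynomials. -/
def fibPoly (l : ℕ) (b : ℤ) : Submodule ℂ (MvPolynomial ℤ ℂ) :=
  Submodule.span ℂ {f | ∃ s, IsFib l b s ∧ f = ∏ i ∈ s, MvPolynomial.X i}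

/-- The algebra `ℂ{x_i | i ∈ ℤ}` of polynomials in anticommuting variables. -/
abbrev AntiPoly : Type := ExteriorAlgebra ℂ (ℤ →₀ ℂ)

/-- The anticommuting variable `x_i`. -/
def antiX (i : ℤ) : AntiPoly := ExteriorAlgebra.ι ℂ (Finsupp.single i 1)

/-- The space `ℂ^F_l{x_i | i ≤ b}` of anti-symmetric Fibonacci-`l` polynomials, spanned by the
products `x_{i_1} ⋯ x_{i_k}`, `i_1 < ⋯ < i_k`, over Fibonacci index sets. -/
def fibAntiPoly (l : ℕ) (b : ℤ) : Submodule ℂ AntiPoly :=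
  Submodule.span ℂ {f | ∃ s, IsFib l b s ∧ f = ((s.sort (· ≤ ·)).map antiX).prod}

/-- The operator `L_0` of the conformal vector `½ a_{-1}² + lam a_{-2}`, that is
`½ a_0² + ∑_{n>0} a_{-n} a_n - lam a_0`. -/
def L0 (M : ℕ) (lam : ℂ) : Module.End ℂ LatticeSpace :=
  (1 / 2 : ℂ) • (a M 0 * a M 0)
    + locallyFiniteSum (fun k => a M (-((k : ℤ) + 1)) * a M ((k : ℤ) + 1)) (a_mul_a_finite M)
    - lam • a M 0

/-- Vectors of bidegree `z ^ m q ^ d`: `a_0 = m√M` and `L_0 = d`. -/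
def bidegree (M : ℕ) (lam : ℂ) (m : ℤ) (d : ℕ) : Submodule ℂ LatticeSpace :=
  Module.End.eigenspace (a M 0) ((m : ℂ) * root M) ⊓ Module.End.eigenspace (L0 M lam) (d : ℂ)

/-- `ch W = ∑_m z^m χ_m(q)`, where `ch W = Tr_W z^{a_0/√M} q^{L_0}`: the subspace `W` is the (direct)
sum of its bihomogeneous components, these are finite dimensional, and the dimension of the
component of bidegree `z ^ m q ^ d` is the coefficient of `q ^ d` in `χ_m`. -/
def HasCharacter (M : ℕ) (lam : ℂ) (W : Submodule ℂ LatticeSpace) (χ : ℤ → PowerSeries ℚ) :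
    Prop :=
  W = (⨆ (m : ℤ) (d : ℕ), W ⊓ bidegree M lam m d) ∧
  ∀ (m : ℤ) (d : ℕ), FiniteDimensional ℂ ↥(W ⊓ bidegree M lam m d) ∧
    (Module.finrank ℂ ↥(W ⊓ bidegree M lam m d) : ℚ) = PowerSeries.coeff d (χ m)

/-- `(q)_n = (1 - q)(1 - q²) ⋯ (1 - qⁿ)`. -/
def qPoch (n : ℕ) : PowerSeries ℚ := ∏ k ∈ Finset.range n, (1 - PowerSeries.X ^ (k + 1))

/-- The series `∑_{m ≥ j} z^m q^{N m²} / (q)_{m-j}`. -/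
def chEven (N : ℕ) (j : ℤ) : ℤ → PowerSeries ℚ := fun m =>
  if j ≤ m then PowerSeries.X ^ (N * m.natAbs ^ 2) * (qPoch (m - j).toNat)⁻¹ else 0

/-- The series `∑_{m ≥ j} z^m q^{(2N+1) m(m-1)/2} / (q)_{m-j}`. -/
def chOdd (N : ℕ) (j : ℤ) : ℤ → PowerSeries ℚ := fun m =>
  if j ≤ m then
    PowerSeries.X ^ ((2 * N + 1) * (m * (m - 1) / 2).toNat) * (qPoch (m - j).toNat)⁻¹
  else 0

end LatticeVOA

end

/-! Every Fock module is modelled on ℂ[x₁, x₂, …]. The creation exponential multiplies by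
polynomials h_p with generating series H(X) = ∑ h_p X^p, and by Taylor's formula the annihilation
exponential is the translation x_n ↦ x_n - √M yⁿ with y = z⁻¹. Translation multiplies H(X) by (1 -
yX)^M (`transl_h`), so the modes act explicitly on products of h's (`vertexCoeff_single`), and the
symmetry of the coefficients of (1 - t)^M makes them commute or anticommute according to the parity
of M.

Let b be the largest allowed index. Applied to |j√M⟩, the monomial with index list i₁, …, i_k equals
h_{p₁}⋯h_{p_k}, p_r = b - i_r - M(k - r), plus products in which weight has moved to earlier factors
(`modes_prod_vac`). The Fibonacci condition says that the gaps of the i_r are at least M, that is,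
that the p_r decrease weakly; the bound i_k ≤ b says that p_k ≥ 0. So Fibonacci index sets of size k
correspond to multisets of k natural numbers (`fibEquiv`). Moving weight forward in a weakly
decreasing list strictly increases ∑ p_r² (`SuffixLE.sum_sq_le`), so the Fibonacci vectors are
unitriangular over the products of h's.

The h_n with n ≥ 1 are algebraically independent and h_0 = 1. Since the lattice degree records the
number of factors, the vectors `hVec` are linearly independent. As ∑ p_r² ≤ (∑ p_r)², triangularity
transfers both independence and span to the Fibonacci vectors. The span of the `hVec` contains |j√M⟩
and is stable under all modes, so it is the whole basic subspace. Each `hVec` is a joint eigenvector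
of a_0 and L_0, whose eigenvalues depend only on the number of factors and on ∑ p_r; multisets of k
natural numbers are counted by 1/(q)_k. -/

noncomputable section

namespace LatticeVOA

/-! ### Exponentials of power series through the equation X G' = B G -/

section Newton

variable {E : Type*} [Semiring E]

theorem nsmul_cancel {E : Type*} [AddCommMonoid E] [Module ℂ E] {n : ℕ} (hn : n ≠ 0) {x y : E}
    (h : n • x = n • y) : x = y := by
  rw [← Nat.cast_smul_eq_nsmul ℂ, ← Nat.cast_smul_eq_nsmul ℂ] at h
  have hn' : (n : ℂ) ≠ 0 := Nat.cast_ne_zero.mpr hn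
  rw [← one_smul ℂ x, ← one_smul ℂ y, ← inv_mul_cancel₀ hn', mul_smul, mul_smul, h]

/-- The operator `X d/dX` on power series with coefficients in a possibly noncommutative ring. -/
def eulerDeriv : PowerSeries E →+ PowerSeries E where
  toFun f := PowerSeries.mk fun n => n • PowerSeries.coeff n f
  map_zero' := by ext; simp
  map_add' f g := by ext; simp

@[simp]
theorem coeff_eulerDeriv (f : PowerSeries E) (n : ℕ) :
    PowerSeries.coeff n (eulerDeriv f) = n • PowerSeries.coeff n f := by
  simp [eulerDeriv]

theorem eulerDeriv_mul (f g : PowerSeries E) :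
    eulerDeriv (f * g) = eulerDeriv f * g + f * eulerDeriv g := by
  ext n
  simp only [coeff_eulerDeriv, PowerSeries.coeff_mul, map_add, Finset.smul_sum,
    ← Finset.sum_add_distrib]
  refine Finset.sum_congr rfl fun p hp => ?_
  rw [Finset.HasAntidiagonal.mem_antidiagonal] at hp
  rw [← hp, add_smul, smul_mul_assoc, mul_smul_comm]

theorem eulerDeriv_one : eulerDeriv (1 : PowerSeries E) = 0 := by
  ext n
  rw [coeff_eulerDeriv, PowerSeries.coeff_one]
  split_ifs with h <;> simp [h]

theorem commute_of_coeff {f g : PowerSeries E}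
    (h : ∀ m n, Commute (PowerSeries.coeff m f) (PowerSeries.coeff n g)) : Commute f g := by
  ext n
  rw [PowerSeries.coeff_mul, PowerSeries.coeff_mul, ← Finset.Nat.sum_antidiagonal_swap]
  exact Finset.sum_congr rfl fun p _ => h _ _

theorem eulerDeriv_pow {f : PowerSeries E} (h : Commute f (eulerDeriv f)) (k : ℕ) :
    eulerDeriv (f ^ (k + 1)) = (k + 1) • (eulerDeriv f * f ^ k) := by
  induction k with
  | zero => simp
  | succ k ih =>
    rw [pow_succ, eulerDeriv_mul, ih, (h.pow_left (k + 1)).eq, smul_mul_assoc, mul_assoc,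
      ← pow_succ, ← succ_nsmul]

/-- `G` is the exponential of a primitive of `B` with respect to `X d/dX`: the constant coefficient
of `G` is `1` and `X G' = B G`. -/
structure IsExpPrimitive (B G : PowerSeries E) : Prop where
  coeff_zero : PowerSeries.coeff 0 G = 1
  euler : eulerDeriv G = B * G

theorem IsExpPrimitive.coeff_eq {B G : PowerSeries E} (h : IsExpPrimitive B G) (n : ℕ) :
    n • PowerSeries.coeff n G =
      ∑ p ∈ Finset.HasAntidiagonal.antidiagonal n, PowerSeries.coeff p.1 B * PowerSeries.coeff p.2 G := by
  rw [← PowerSeries.coeff_mul, ← h.euler, coeff_eulerDeriv]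

/-- With B(0) = 0 the equation reads n g_n = ∑_{i ≥ 1} b_i g_{n-i}, a recursion that determines G
after division by n. Two exponentials are thus identified by comparing their logarithmic
derivatives. -/
theorem IsExpPrimitive.ext [Algebra ℂ E] {B G G' : PowerSeries E}
    (hB : PowerSeries.coeff 0 B = 0)
    (h : IsExpPrimitive B G) (h' : IsExpPrimitive B G') : G = G' := by
  ext n
  induction n using Nat.strong_induction_on with
  | _ n ih =>
    rcases Nat.eq_zero_or_pos n with rfl | hn
    · rw [h.coeff_zero, h'.coeff_zero]
    · refine nsmul_cancel hn.ne' ?_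
      rw [h.coeff_eq, h'.coeff_eq]
      refine Finset.sum_congr rfl fun p hp => ?_
      rw [Finset.HasAntidiagonal.mem_antidiagonal] at hp
      rcases Nat.eq_zero_or_pos p.1 with h0 | h0
      · rw [h0, hB, zero_mul, zero_mul]
      · rw [ih p.2 (by omega)]

theorem IsExpPrimitive.map {E' : Type*} [Semiring E'] (f : E →+* E') {B G : PowerSeries E}
    (h : IsExpPrimitive B G) : IsExpPrimitive (PowerSeries.map f B) (PowerSeries.map f G) where
  coeff_zero := by rw [PowerSeries.coeff_map, h.coeff_zero, map_one]
  euler := by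
    rw [← map_mul, ← h.euler]
    ext n
    simp

theorem IsExpPrimitive.mul {E : Type*} [CommSemiring E] {B G B' G' : PowerSeries E}
    (h : IsExpPrimitive B G) (h' : IsExpPrimitive B' G') : IsExpPrimitive (B + B') (G * G') where
  coeff_zero := by
    rw [PowerSeries.coeff_mul, Finset.Nat.antidiagonal_zero, Finset.sum_singleton,
      h.coeff_zero, h'.coeff_zero, one_mul]
  euler := by rw [eulerDeriv_mul, h.euler, h'.euler]; ring

theorem IsExpPrimitive.pow {E : Type*} [CommSemiring E] {B G : PowerSeries E}
    (h : IsExpPrimitive B G) (k : ℕ) : IsExpPrimitive (k • B) (G ^ k) := by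
  induction k with
  | zero => exact ⟨by simp, by simp [eulerDeriv_one]⟩
  | succ k ih => rw [pow_succ, succ_nsmul]; exact ih.mul h

theorem IsExpPrimitive.commute_coeff [Algebra ℂ E] {B G : PowerSeries E}
    (hB : PowerSeries.coeff 0 B = 0) (h : IsExpPrimitive B G) {x : E}
    (hx : ∀ k, Commute x (PowerSeries.coeff k B)) (n : ℕ) :
    Commute x (PowerSeries.coeff n G) := by
  induction n using Nat.strong_induction_on with
  | _ n ih =>
    rcases Nat.eq_zero_or_pos n with rfl | hn
    · rw [h.coeff_zero]; exact Commute.one_right x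
    · refine nsmul_cancel hn.ne' ?_
      rw [← mul_smul_comm, ← smul_mul_assoc, h.coeff_eq]
      refine (Commute.sum_right _ _ _ fun p hp => ?_).eq
      rw [Finset.HasAntidiagonal.mem_antidiagonal] at hp
      rcases Nat.eq_zero_or_pos p.1 with h0 | h0
      · rw [h0, hB, zero_mul]; exact Commute.zero_right x
      · exact (hx _).mul_right (ih p.2 (by omega))

/-- The coefficients of the solution `G` of `X G' = B G`, `G(0) = 1`. -/
def newton [Algebra ℂ E] (b : ℕ → E) : ℕ → E
  | 0 => 1
  | n + 1 => ((n : ℂ) + 1)⁻¹ • ∑ i : Fin (n + 1), b (n + 1 - i) * newton b i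

theorem isExpPrimitive_newton [Algebra ℂ E] {b : ℕ → E} (hb : b 0 = 0) :
    IsExpPrimitive (PowerSeries.mk b) (PowerSeries.mk (newton b)) where
  coeff_zero := by rw [PowerSeries.coeff_mk, newton]
  euler := by
    ext n
    rw [coeff_eulerDeriv, PowerSeries.coeff_mk, PowerSeries.coeff_mul]
    simp only [PowerSeries.coeff_mk]
    cases n with
    | zero => simp [hb]
    | succ n =>
      rw [newton, ← Nat.cast_smul_eq_nsmul ℂ, smul_smul, Nat.cast_succ,
        mul_inv_cancel₀ (Nat.cast_add_one_ne_zero n), one_smul,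
        ← Finset.Nat.sum_antidiagonal_swap, Finset.Nat.sum_antidiagonal_eq_sum_range_succ_mk,
        Finset.sum_range_succ]
      simp [hb, Finset.sum_range]

end Newton

theorem coeff_pow_eq_zero {E : Type*} [Semiring E] {A : PowerSeries E}
    (hA : PowerSeries.coeff 0 A = 0) {k i : ℕ} (h : i < k) :
    PowerSeries.coeff i (A ^ k) = 0 := by
  induction k generalizing i with
  | zero => omega
  | succ k ih =>
    rw [pow_succ, PowerSeries.coeff_mul]
    refine Finset.sum_eq_zero fun p hp => ?_
    rw [Finset.HasAntidiagonal.mem_antidiagonal] at hp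
    by_cases h0 : p.2 = 0
    · rw [h0, hA, mul_zero]
    · rw [ih (by omega), zero_mul]

/-- The coefficients of `exp A`, for a series `A` without constant term. -/
def expSeries {E : Type*} [Semiring E] [Algebra ℂ E] (A : PowerSeries E) : PowerSeries E :=
  PowerSeries.mk fun p =>
    ∑ k ∈ Finset.range (p + 1), ((k.factorial : ℂ)⁻¹) • PowerSeries.coeff p (A ^ k)

/-- The coefficients of A commute, so A commutes with X A' and the usual derivative of A^k / k! is
available over a noncommutative ring. -/
theorem isExpPrimitive_expSeries {E : Type*} [Semiring E] [Algebra ℂ E] {A : PowerSeries E}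
    (hA : PowerSeries.coeff 0 A = 0)
    (hc : ∀ m n, Commute (PowerSeries.coeff m A) (PowerSeries.coeff n A)) :
    IsExpPrimitive (eulerDeriv A) (expSeries A) where
  coeff_zero := by
    rw [expSeries, PowerSeries.coeff_mk, zero_add, Finset.sum_range_one, pow_zero,
      PowerSeries.coeff_zero_one, Nat.factorial_zero, Nat.cast_one, inv_one, one_smul]
  euler := by
    have hcomm : Commute A (eulerDeriv A) := commute_of_coeff fun m n => by
      rw [coeff_eulerDeriv]; exact (hc m n).smul_right _
    -- Since A^k starts in degree k, the truncation of the exponential sum may be placed anywhere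
    -- beyond the degree read off.
    have hext : ∀ {i n : ℕ}, i < n → ∑ k ∈ Finset.range n,
        ((k.factorial : ℂ)⁻¹) • PowerSeries.coeff i (A ^ k) = PowerSeries.coeff i (expSeries A) := by
      intro i n hin
      rw [expSeries, PowerSeries.coeff_mk]
      refine (Finset.sum_subset (Finset.range_subset_range.mpr hin) fun k _ hk => ?_).symm
      rw [coeff_pow_eq_zero hA (by simpa using hk), smul_zero]
    ext1 n
    rw [coeff_eulerDeriv, PowerSeries.coeff_mul]
    calc n • PowerSeries.coeff n (expSeries A)
        = ∑ k ∈ Finset.range (n + 1),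
            ((k.factorial : ℂ)⁻¹) • PowerSeries.coeff n (eulerDeriv (A ^ k)) := by
          rw [expSeries, PowerSeries.coeff_mk, Finset.smul_sum]
          refine Finset.sum_congr rfl fun k _ => ?_
          rw [coeff_eulerDeriv, smul_comm]
      _ = ∑ k ∈ Finset.range n,
            ((k.factorial : ℂ)⁻¹) • PowerSeries.coeff n (eulerDeriv A * A ^ k) := by
          rw [Finset.sum_range_succ', pow_zero, eulerDeriv_one, map_zero, smul_zero, add_zero]
          refine Finset.sum_congr rfl fun k _ => ?_
          rw [eulerDeriv_pow hcomm, map_nsmul, ← Nat.cast_smul_eq_nsmul ℂ, smul_smul,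
            Nat.factorial_succ]
          congr 1
          have : ((k : ℂ) + 1) ≠ 0 := Nat.cast_add_one_ne_zero k
          push_cast
          field_simp
      _ = _ := by
          simp only [PowerSeries.coeff_mul, Finset.smul_sum]
          rw [Finset.sum_comm]
          refine Finset.sum_congr rfl fun p hp => ?_
          rw [Finset.HasAntidiagonal.mem_antidiagonal] at hp
          rcases Nat.eq_zero_or_pos p.1 with h0 | h0
          · simp [h0]
          · rw [← hext (show p.2 < n by omega), Finset.mul_sum]
            refine Finset.sum_congr rfl fun k _ => ?_
            rw [mul_smul_comm]

theorem expCoeff_eq (A : PowerSeries (Module.End ℂ LatticeSpace)) (p : ℕ) :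
    expCoeff A p = PowerSeries.coeff p (expSeries A) := by
  rw [expSeries, PowerSeries.coeff_mk, expCoeff]

/-! ### Heisenberg operators on the polynomial model -/

theorem root_mul_root (M : ℕ) : root M * root M = M := by
  rw [root, ← Complex.ofReal_mul, Real.mul_self_sqrt (Nat.cast_nonneg M), Complex.ofReal_natCast]

theorem root_ne_zero {M : ℕ} (hM : 0 < M) : root M ≠ 0 := by
  intro h
  have := root_mul_root M
  rw [h, mul_zero] at this
  exact hM.ne (by exact_mod_cast this)

/-- The variable `x_k` for `k > 0`, and `0` for `k = 0`. -/
def xvar : ℕ → MvPolynomial ℕ+ ℂ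
  | 0 => 0
  | n + 1 => MvPolynomial.X n.succPNat

/-- The operator `k ∂/∂x_k` (and `0` for `k = 0`). -/
def dvar : ℕ → Module.End ℂ (MvPolynomial ℕ+ ℂ)
  | 0 => 0
  | n + 1 => ((n : ℂ) + 1) • (MvPolynomial.pderiv n.succPNat).toLinearMap

theorem dvar_C (k : ℕ) (c : ℂ) : dvar k (MvPolynomial.C c) = 0 := by
  cases k with
  | zero => simp [dvar]
  | succ n => simp [dvar]

theorem dvar_mul (k : ℕ) (P Q : MvPolynomial ℕ+ ℂ) :
    dvar k (P * Q) = dvar k P * Q + P * dvar k Q := by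
  cases k with
  | zero => simp [dvar]
  | succ n =>
    simp only [dvar, LinearMap.smul_apply, Derivation.coeFn_coe, Derivation.leibniz, smul_eq_mul]
    rw [smul_add, mul_smul_comm, smul_mul_assoc, add_comm, mul_comm Q]

theorem dvar_X (k : ℕ) (n : ℕ+) :
    dvar k (MvPolynomial.X n) = if k = n then MvPolynomial.C (n : ℂ) else 0 := by
  cases k with
  | zero => simp [dvar, n.ne_zero.symm]
  | succ m =>
    simp only [dvar, LinearMap.smul_apply, Derivation.coeFn_coe, MvPolynomial.pderiv_X, Pi.single_apply]
    by_cases h : m.succPNat = n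
    · subst h
      simp [MvPolynomial.smul_eq_C_mul]
    · have h' : m + 1 ≠ (n : ℕ) := fun e => h (PNat.eq e)
      rw [if_neg h', if_neg (fun e => h e.symm), smul_zero]

theorem dvar_commute (k l : ℕ) : Commute (dvar k) (dvar l) := by
  cases k with
  | zero => exact Commute.zero_left _
  | succ k =>
  cases l with
  | zero => exact Commute.zero_right _
  | succ l =>
    refine Commute.smul_left (Commute.smul_right (?_ : _ * _ = _ * _) _) _
    refine LinearMap.ext fun P => ?_
    have h : (⁅MvPolynomial.pderiv (R := ℂ) k.succPNat, MvPolynomial.pderiv (R := ℂ) l.succPNat⁆ :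
        Derivation ℂ (MvPolynomial ℕ+ ℂ) (MvPolynomial ℕ+ ℂ)) = 0 := by
      refine MvPolynomial.derivation_ext (R := ℂ) fun n => ?_
      simp only [Derivation.commutator_apply, MvPolynomial.pderiv_X, Pi.single_apply]
      split_ifs <;> simp
    have := congrArg (fun D => D P) h
    rw [Derivation.commutator_apply] at this
    exact sub_eq_zero.mp this

/-- Operators on `ℂ[x₁, x₂, …]` acting on every summand of the lattice space. -/
def summandwise : Module.End ℂ (MvPolynomial ℕ+ ℂ) →ₐ[ℂ] Module.End ℂ LatticeSpace where
  toFun T := Finsupp.mapRange.linearMap T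
  map_one' := by ext; simp
  map_mul' S T := by ext; simp
  map_zero' := by ext; simp
  map_add' S T := by ext; simp
  commutes' c := by ext; simp [Algebra.algebraMap_eq_smul_one]

theorem summandwise_single (T : Module.End ℂ (MvPolynomial ℕ+ ℂ)) (m : ℤ)
    (P : MvPolynomial ℕ+ ℂ) :
    summandwise T (Finsupp.single m P) = Finsupp.single m (T P) :=
  Finsupp.mapRange_single (hf := map_zero T)

theorem a_neg (M : ℕ) {k : ℕ} (hk : k ≠ 0) :
    a M (-(k : ℤ)) = summandwise (Algebra.lmul ℂ _ (xvar k)) := by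
  obtain ⟨n, rfl⟩ := Nat.exists_eq_succ_of_ne_zero hk
  rfl

theorem a_pos (M : ℕ) {k : ℕ} (hk : k ≠ 0) : a M (k : ℤ) = summandwise (dvar k) := by
  obtain ⟨n, rfl⟩ := Nat.exists_eq_succ_of_ne_zero hk
  rw [dvar, map_smul]
  rfl

theorem a_zero_single (M : ℕ) (m : ℤ) (P : MvPolynomial ℕ+ ℂ) :
    a M 0 (Finsupp.single m P) = Finsupp.single m (((m : ℂ) * root M) • P) := by
  change Finsupp.lsum ℂ (fun m : ℤ => ((m : ℂ) * root M) • Finsupp.lsingle m)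
    (Finsupp.single m P) = _
  simp

/-! ### The creation exponential as multiplication, the annihilation exponential as translation -/

/-- The coefficients of `exp (√M ∑_{k>0} x_k z^k / k)`. -/
def h (M : ℕ) : ℕ → MvPolynomial ℕ+ ℂ := newton fun k => root M • xvar k

theorem h_zero (M : ℕ) : h M 0 = 1 := by rw [h, newton]

theorem isExpPrimitive_h (M : ℕ) :
    IsExpPrimitive (PowerSeries.mk fun k => root M • xvar k) (PowerSeries.mk (h M)) :=
  isExpPrimitive_newton (by simp [xvar])


theorem creationExp_natCast (M p : ℕ) :
    creationExp M (p : ℤ) = summandwise (Algebra.lmul ℂ _ (h M p)) := by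
  have hcoeff : ∀ k, PowerSeries.coeff k (eulerDeriv (creationSeries M)) =
      summandwise (Algebra.lmul ℂ _ (root M • xvar k)) := by
    intro k
    rw [coeff_eulerDeriv, creationSeries, PowerSeries.coeff_mk]
    split_ifs with hk
    · simp [hk, xvar]
    · rw [a_neg M hk, ← Nat.cast_smul_eq_nsmul ℂ, smul_smul,
        mul_div_cancel₀ _ (Nat.cast_ne_zero.mpr hk), map_smul, map_smul]
  have hcoeff' : ∀ k, PowerSeries.coeff k (creationSeries M) =
      summandwise (Algebra.lmul ℂ _ ((root M / (k : ℂ)) • xvar k)) := by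
    intro k
    rw [creationSeries, PowerSeries.coeff_mk]
    split_ifs with hk
    · simp [hk, xvar]
    · rw [a_neg M hk, map_smul, map_smul]
  have h1 := isExpPrimitive_expSeries (A := creationSeries M)
    (by rw [hcoeff']; simp)
    (fun m n => by
      rw [hcoeff', hcoeff']
      exact ((Commute.all _ _).map _).map _)
  have h2 := (isExpPrimitive_h M).map
    ((summandwise.comp (Algebra.lmul ℂ (MvPolynomial ℕ+ ℂ))).toRingHom)
  have hB : eulerDeriv (creationSeries M) = PowerSeries.map
      ((summandwise.comp (Algebra.lmul ℂ (MvPolynomial ℕ+ ℂ))).toRingHom)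
      (PowerSeries.mk fun k => root M • xvar k) := by
    ext1 k
    rw [hcoeff, PowerSeries.coeff_map, PowerSeries.coeff_mk]
    rfl
  rw [← hB] at h2
  rw [creationExp, if_pos (Int.natCast_nonneg p), Int.toNat_natCast, expCoeff_eq,
    h1.ext (by simp) h2, PowerSeries.coeff_map, PowerSeries.coeff_mk]
  rfl

/-- The translation `x_n ↦ x_n - √M y ^ n`. -/
def transl (M : ℕ) : MvPolynomial ℕ+ ℂ →ₐ[ℂ] Polynomial (MvPolynomial ℕ+ ℂ) :=
  MvPolynomial.aeval fun n => Polynomial.C (MvPolynomial.X n) - root M • Polynomial.X ^ (n : ℕ)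

theorem transl_X (M : ℕ) (n : ℕ+) : transl M (MvPolynomial.X n) =
    Polynomial.C (MvPolynomial.X n) - root M • Polynomial.X ^ (n : ℕ) := by
  rw [transl, MvPolynomial.aeval_X]

/-- The coefficient of `y ^ r` in the translation. -/
def translCoeff (M r : ℕ) : Module.End ℂ (MvPolynomial ℕ+ ℂ) :=
  (Polynomial.lcoeff (MvPolynomial ℕ+ ℂ) r).restrictScalars ℂ ∘ₗ (transl M).toLinearMap

theorem translCoeff_apply (M r : ℕ) (P : MvPolynomial ℕ+ ℂ) :
    translCoeff M r P = (transl M P).coeff r := rfl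

theorem translCoeff_zero (M : ℕ) : translCoeff M 0 = 1 := by
  have : ((Polynomial.aeval (0 : MvPolynomial ℕ+ ℂ)).restrictScalars ℂ).comp (transl M) =
      AlgHom.id ℂ (MvPolynomial ℕ+ ℂ) := by
    ext1 n
    simp [transl_X]
  refine LinearMap.ext fun P => ?_
  have h := congrArg (fun f => f P) this
  simpa [translCoeff_apply, Polynomial.coeff_zero_eq_eval_zero] using h

theorem sum_antidiagonal_shift {E : Type*} [AddCommMonoid E] (G : ℕ → ℕ → E) (n r : ℕ) :
    ∑ p ∈ Finset.HasAntidiagonal.antidiagonal r, (if n ≤ p.2 then G p.1 (p.2 - n) else 0) =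
      if n ≤ r then ∑ p ∈ Finset.HasAntidiagonal.antidiagonal (r - n), G p.1 p.2 else 0 := by
  rw [← Finset.sum_filter]
  split_ifs with hn
  · rw [Finset.Nat.antidiagonal_filter_le_snd_of_le hn, Finset.sum_map]
    simp
  · refine Finset.sum_eq_zero fun p hp => ?_
    simp only [Finset.mem_filter, Finset.HasAntidiagonal.mem_antidiagonal] at hp
    omega

/-- This is Taylor's formula in differential form: translation by -√M yⁿ in each x_n satisfies the
equation that defines the exponential of the annihilation series. It is checked by adding one
variable at a time to a monomial. -/
theorem isExpPrimitive_translCoeff (M : ℕ) :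
    IsExpPrimitive (PowerSeries.mk fun k => (-root M) • dvar k)
      (PowerSeries.mk (translCoeff M)) where
  coeff_zero := by rw [PowerSeries.coeff_mk, translCoeff_zero]
  euler := by
    ext1 r
    rw [coeff_eulerDeriv, PowerSeries.coeff_mul]
    simp only [PowerSeries.coeff_mk]
    refine LinearMap.ext fun P => ?_
    rw [LinearMap.sum_apply, LinearMap.smul_apply]
    simp only [Module.End.mul_apply, LinearMap.smul_apply, translCoeff_apply]
    induction P using MvPolynomial.induction_on generalizing r with
    | C c =>
      have : transl M (MvPolynomial.C c) = Polynomial.C (MvPolynomial.C c) := by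
        rw [transl, MvPolynomial.aeval_C]; rfl
      rw [this, Polynomial.coeff_C]
      have h0 : ∀ p ∈ Finset.HasAntidiagonal.antidiagonal r, -root M • dvar p.1
          ((Polynomial.C (MvPolynomial.C c : MvPolynomial ℕ+ ℂ)).coeff p.2) = 0 := by
        intro p _
        rw [Polynomial.coeff_C]
        split_ifs
        · rw [dvar_C, smul_zero]
        · rw [map_zero, smul_zero]
      rw [Finset.sum_eq_zero h0]
      split_ifs with h <;> simp [h]
    | add P Q hP hQ =>
      simp only [map_add, Polynomial.coeff_add, smul_add, Finset.sum_add_distrib, hP, hQ]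
    | mul_X P n ih =>
      set f := transl M P
      have hc : ∀ i, (transl M (P * MvPolynomial.X n)).coeff i =
          f.coeff i * MvPolynomial.X n -
            root M • (if (n : ℕ) ≤ i then f.coeff (i - n) else 0) := by
        intro i
        rw [map_mul, transl_X, mul_sub, mul_smul_comm, Polynomial.coeff_sub,
          Polynomial.coeff_mul_C, Polynomial.coeff_smul, Polynomial.coeff_mul_X_pow']
      -- By the Leibniz rule x_n is differentiated only when `p.1 = n`. The resulting factor n
      -- completes the weight r - n coming from the shifted term to r.
      have hd : ∀ p : ℕ × ℕ, -root M • dvar p.1 (f.coeff p.2 * MvPolynomial.X n -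
            root M • (if (n : ℕ) ≤ p.2 then f.coeff (p.2 - n) else 0)) =
          (-root M • dvar p.1 (f.coeff p.2)) * MvPolynomial.X n
          - root M • (if p.1 = (n : ℕ) then f.coeff p.2 * MvPolynomial.C (n : ℂ) else 0)
          - root M • (if (n : ℕ) ≤ p.2 then -root M • dvar p.1 (f.coeff (p.2 - n)) else 0) := by
        intro p
        rw [map_sub, dvar_mul, dvar_X, map_smul, mul_ite, mul_zero, apply_ite (dvar p.1), map_zero,
          smul_mul_assoc]
        split_ifs <;> module
      simp only [hc, hd, Finset.sum_sub_distrib, ← Finset.smul_sum (r := root M), ← Finset.sum_mul]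
      rw [sum_antidiagonal_shift (fun i j => -root M • dvar i (f.coeff j)),
        ← Finset.sum_filter, Finset.HasAntidiagonal.filter_fst_eq_antidiagonal r (n : ℕ)]
      rw [← ih r]
      split_ifs with hn
      · rw [← ih, Finset.sum_singleton, smul_sub, smul_mul_assoc, sub_sub, ← smul_add]
        congr 1
        rw [smul_comm]
        congr 1
        rw [← Nat.cast_smul_eq_nsmul ℂ, ← Nat.cast_smul_eq_nsmul ℂ, mul_comm,
          ← MvPolynomial.smul_eq_C_mul, ← add_smul]
        congr 1
        push_cast [hn]
        ring
      · simp [mul_assoc]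

theorem annihilationExp_eq (M r : ℕ) : annihilationExp M r = summandwise (translCoeff M r) := by
  have hcoeff : ∀ k, PowerSeries.coeff k (eulerDeriv (annihilationSeries M)) =
      summandwise ((-root M) • dvar k) := by
    intro k
    rw [coeff_eulerDeriv, annihilationSeries, PowerSeries.coeff_mk]
    split_ifs with hk
    · simp [hk, dvar]
    · rw [a_pos M hk, ← Nat.cast_smul_eq_nsmul ℂ, smul_smul,
        mul_div_cancel₀ _ (Nat.cast_ne_zero.mpr hk), map_smul]
  have hcoeff' : ∀ k, PowerSeries.coeff k (annihilationSeries M) =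
      summandwise ((-root M / (k : ℂ)) • dvar k) := by
    intro k
    rw [annihilationSeries, PowerSeries.coeff_mk]
    split_ifs with hk
    · simp [hk, dvar]
    · rw [a_pos M hk, map_smul]
  have h1 := isExpPrimitive_expSeries (A := annihilationSeries M)
    (by rw [hcoeff']; simp)
    (fun m n => by
      rw [hcoeff', hcoeff']
      exact (((dvar_commute m n).smul_left _).smul_right _).map summandwise)
  have h2 := (isExpPrimitive_translCoeff M).map summandwise.toRingHom
  have hB : eulerDeriv (annihilationSeries M) = PowerSeries.map summandwise.toRingHom
      (PowerSeries.mk fun k => (-root M) • dvar k) := by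
    ext1 k
    rw [hcoeff, PowerSeries.coeff_map, PowerSeries.coeff_mk]
    rfl
  rw [← hB] at h2
  rw [annihilationExp, expCoeff_eq, h1.ext (by simp) h2, PowerSeries.coeff_map,
    PowerSeries.coeff_mk]
  rfl

/-- The recursion expresses every coefficient through the commuting derivations `dvar`, hence these
coefficients commute as well. -/
theorem translCoeff_commute (M r s : ℕ) : Commute (translCoeff M r) (translCoeff M s) := by
  have h0 : PowerSeries.coeff 0 (PowerSeries.mk fun k => (-root M) • dvar k) = 0 := by
    simp [dvar]
  have h1 : ∀ k n, Commute (dvar k) (translCoeff M n) := fun k n => by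
    have := (isExpPrimitive_translCoeff M).commute_coeff h0 (x := dvar k)
      (fun l => by rw [PowerSeries.coeff_mk]; exact (dvar_commute k l).smul_right _) n
    rwa [PowerSeries.coeff_mk] at this
  have := (isExpPrimitive_translCoeff M).commute_coeff h0 (x := translCoeff M r)
      (fun l => by rw [PowerSeries.coeff_mk]; exact (h1 l r).symm.smul_right _) s
  rwa [PowerSeries.coeff_mk] at this

/-! ### Explicit action of the modes and their commutation -/

/-- The polynomials `h_p`, extended by zero to negative indices. -/
def hZ (M : ℕ) (p : ℤ) : MvPolynomial ℕ+ ℂ := if 0 ≤ p then h M p.toNat else 0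

theorem hZ_natCast (M p : ℕ) : hZ M (p : ℤ) = h M p := by simp [hZ]

theorem hZ_of_neg (M : ℕ) {p : ℤ} (hp : p < 0) : hZ M p = 0 := if_neg (not_le.mpr hp)

theorem creationExp_eq (M : ℕ) (p : ℤ) :
    creationExp M p = summandwise (Algebra.lmul ℂ _ (hZ M p)) := by
  rcases le_or_gt 0 p with hp | hp
  · obtain ⟨n, rfl⟩ := Int.eq_ofNat_of_zero_le hp
    rw [hZ_natCast, creationExp_natCast]
  · rw [hZ_of_neg M hp, creationExp, if_neg (not_le.mpr hp), map_zero, map_zero]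

/-- The logarithmic derivative of 1 - yX with respect to X d/dX is -∑_{k ≥ 1} y^k X^k. -/
theorem isExpPrimitive_one_sub_mul_X {E : Type*} [CommRing E] (y : E) :
    IsExpPrimitive (PowerSeries.mk fun k => if k = 0 then 0 else -y ^ k)
      (1 - PowerSeries.C y * PowerSeries.X) where
  coeff_zero := by simp
  euler := by
    ext1 n
    rw [coeff_eulerDeriv, mul_sub, mul_one, map_sub, map_sub, ← mul_assoc]
    rcases n with _ | _ | n
    · simp
    · simp [PowerSeries.coeff_succ_mul_X, PowerSeries.coeff_one]
    · simp [PowerSeries.coeff_succ_mul_X, PowerSeries.coeff_one]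
      ring

/-- The coefficients `(-1)^i (M choose i)` of `(1 - t) ^ M`. -/
def altChoose (M i : ℕ) : ℂ := (-1) ^ i * (M.choose i : ℂ)

theorem altChoose_sub {M i : ℕ} (hi : i ≤ M) :
    altChoose M (M - i) = (-1) ^ M * altChoose M i := by
  rw [altChoose, altChoose, Nat.choose_symm hi, ← mul_assoc, ← pow_add]
  congr 1
  obtain ⟨k, rfl⟩ := Nat.exists_eq_add_of_le hi
  rw [Nat.add_sub_cancel_left, add_right_comm, pow_add, ← two_mul, pow_mul]
  simp

theorem one_sub_C_mul_X_pow {E : Type*} [CommRing E] (y : E) (M : ℕ) :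
    (1 - PowerSeries.C y * PowerSeries.X) ^ M = ∑ i ∈ Finset.range (M + 1),
      PowerSeries.C (y ^ i * ((-1) ^ i * (M.choose i : E))) * PowerSeries.X ^ i := by
  rw [sub_eq_neg_add, add_pow]
  refine Finset.sum_congr rfl fun i _ => ?_
  rw [neg_pow, mul_pow]
  simp only [map_mul, map_pow, map_neg, map_one, map_natCast]
  ring

/-- Translation sends √M x_k to √M x_k - M y^k. On logarithmic derivatives this adds M times that of
1 - yX, so the generating series of the h's is multiplied by (1 - yX)^M. -/
theorem transl_h (M p : ℕ) : transl M (h M p) = ∑ i ∈ Finset.range (M + 1),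
    altChoose M i • (Polynomial.C (hZ M (p - i)) * Polynomial.X ^ i) := by
  have h1 := (isExpPrimitive_h M).map (transl M).toRingHom
  have h2 := ((isExpPrimitive_h M).map Polynomial.C).mul
    ((isExpPrimitive_one_sub_mul_X (Polynomial.X : Polynomial (MvPolynomial ℕ+ ℂ))).pow M)
  have hB : PowerSeries.map (transl M).toRingHom (PowerSeries.mk fun k => root M • xvar k) =
      PowerSeries.map Polynomial.C (PowerSeries.mk fun k => root M • xvar k) +
      M • PowerSeries.mk fun k => if k = 0 then 0 else -Polynomial.X ^ k := by
    ext1 k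
    rw [map_add, map_nsmul, PowerSeries.coeff_map, PowerSeries.coeff_map, PowerSeries.coeff_mk,
      PowerSeries.coeff_mk]
    cases k with
    | zero => simp [xvar]
    | succ n =>
      rw [if_neg n.succ_ne_zero, xvar]
      change transl M (root M • _) = _
      rw [map_smul, transl_X, smul_sub, smul_smul, root_mul_root, Polynomial.smul_C, smul_neg,
        ← Nat.cast_smul_eq_nsmul ℂ, sub_eq_add_neg]
      rfl
  rw [← hB] at h2
  have h3 := congrArg (PowerSeries.coeff p) (h1.ext (by simp [xvar]) h2)
  rw [PowerSeries.coeff_map, PowerSeries.coeff_mk] at h3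
  refine Eq.trans h3 ?_
  rw [one_sub_C_mul_X_pow, Finset.mul_sum, map_sum]
  refine Finset.sum_congr rfl fun i _ => ?_
  rw [mul_left_comm, PowerSeries.coeff_C_mul, PowerSeries.coeff_mul_X_pow',
    PowerSeries.coeff_map, PowerSeries.coeff_mk]
  have e2 : ∀ f : Polynomial (MvPolynomial ℕ+ ℂ), altChoose M i • f =
      Polynomial.C (MvPolynomial.C (altChoose M i)) * f := fun f => by
    rw [Algebra.smul_def]; rfl
  have e3 : ((-1) ^ i * (M.choose i : Polynomial (MvPolynomial ℕ+ ℂ))) =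
      Polynomial.C (MvPolynomial.C (altChoose M i)) := by
    simp only [altChoose, map_mul, map_pow, map_neg, map_one, map_natCast]
  rw [e2, e3]
  split_ifs with hi
  · rw [← Nat.cast_sub hi, hZ_natCast]
    ring
  · rw [hZ_of_neg M (by omega)]
    simp

theorem transl_hZ (M : ℕ) (p : ℤ) : transl M (hZ M p) = ∑ i ∈ Finset.range (M + 1),
    altChoose M i • (Polynomial.C (hZ M (p - i)) * Polynomial.X ^ i) := by
  rcases le_or_gt 0 p with hp | hp
  · obtain ⟨n, rfl⟩ := Int.eq_ofNat_of_zero_le hp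
    rw [hZ_natCast, transl_h]
  · rw [hZ_of_neg M hp, map_zero, Finset.sum_eq_zero]
    intro i _
    rw [hZ_of_neg M (by omega)]
    simp

/-- The linear map `∑ c_r y^r ↦ ∑ h_{p+r} c_r`. -/
def pairing (M : ℕ) (p : ℤ) :
    Polynomial (MvPolynomial ℕ+ ℂ) →ₗ[MvPolynomial ℕ+ ℂ] MvPolynomial ℕ+ ℂ :=
  Polynomial.lsum fun r => LinearMap.mulLeft _ (hZ M (p + r))

theorem pairing_C_mul (M : ℕ) (p : ℤ) (c : MvPolynomial ℕ+ ℂ)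
    (f : Polynomial (MvPolynomial ℕ+ ℂ)) :
    pairing M p (Polynomial.C c * f) = c * pairing M p f := by
  rw [← Polynomial.smul_eq_C_mul, map_smul, smul_eq_mul]

theorem pairing_smul (M : ℕ) (p : ℤ) (c : ℂ) (f : Polynomial (MvPolynomial ℕ+ ℂ)) :
    pairing M p (c • f) = c • pairing M p f :=
  LinearMap.map_smul_of_tower _ _ _

theorem pairing_monomial (M : ℕ) (p : ℤ) (r : ℕ) (c : MvPolynomial ℕ+ ℂ) :
    pairing M p (Polynomial.monomial r c) = hZ M (p + r) * c := by
  rw [pairing, Polynomial.lsum_apply]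
  exact Polynomial.sum_monomial_index _ _ (map_zero _)

theorem pairing_mul_X_pow (M : ℕ) (p : ℤ) (i : ℕ) (f : Polynomial (MvPolynomial ℕ+ ℂ)) :
    pairing M p (f * Polynomial.X ^ i) = pairing M (p + i) f := by
  induction f using Polynomial.induction_on' with
  | add f g hf hg => rw [add_mul, map_add, hf, hg, map_add]
  | monomial r c =>
    rw [Polynomial.monomial_mul_X_pow, pairing_monomial, pairing_monomial]
    congr 2
    push_cast
    ring

theorem pairing_eq_sum (M : ℕ) (p : ℤ) {f : Polynomial (MvPolynomial ℕ+ ℂ)} {K : ℕ}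
    (hK : ∀ u, K ≤ u → f.coeff u = 0) :
    pairing M p f = ∑ r ∈ Finset.range K, hZ M (p + r) * f.coeff r := by
  rw [pairing, Polynomial.lsum_apply, Polynomial.sum_def]
  refine Finset.sum_subset (fun u hu => ?_) (fun u _ hu => ?_)
  · by_contra hlt
    exact Polynomial.mem_support_iff.mp hu (hK u (by simpa using hlt))
  · rw [Polynomial.notMem_support_iff.mp hu, map_zero]

/-- The coefficient of y^r in the translation contributes z^{-r} and the lattice factor z^{Mm}, so
the creation part must supply z^{s - Mm + r}; `pairing` collects these terms. -/
theorem vertexCoeff_single (M : ℕ) (s m : ℤ) (P : MvPolynomial ℕ+ ℂ) :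
    vertexCoeff M s (Finsupp.single m P) =
      Finsupp.single (m + 1) (pairing M (s - M * m) (transl M P)) := by
  have hterm : ∀ r : ℕ, ((shift * creationExp M (s + r - M * m)) * annihilationExp M r)
      (Finsupp.single m P) =
        Finsupp.single (m + 1) (hZ M (s - M * m + r) * (transl M P).coeff r) := by
    intro r
    rw [Module.End.mul_apply, Module.End.mul_apply, annihilationExp_eq, creationExp_eq,
      summandwise_single, summandwise_single, shift, Finsupp.lmapDomain_apply,
      Finsupp.mapDomain_single, add_sub_right_comm]
    rfl
  rw [vertexCoeff, Finsupp.lsum_single, LinearMap.comp_apply, Finsupp.lsingle_apply]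
  change (∑ᶠ r : ℕ, ((shift * creationExp M (s + r - M * m)) * annihilationExp M r)
      (Finsupp.single m P)) = _
  simp only [hterm]
  have hK : ∀ u, (transl M P).natDegree + 1 ≤ u → (transl M P).coeff u = 0 :=
    fun u hu => Polynomial.coeff_eq_zero_of_natDegree_lt hu
  rw [pairing_eq_sum M _ hK, ← Finsupp.lsingle_apply (R := ℂ), map_sum]
  refine finsum_eq_sum_of_support_subset _ fun u hu => ?_
  rw [Finset.coe_range, Set.mem_Iio]
  by_contra hlt
  exact hu (by simp only [hK u (not_lt.mp hlt), mul_zero, Finsupp.single_zero])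

theorem pairing_transl_pairing (M : ℕ) (p q : ℤ) (P : MvPolynomial ℕ+ ℂ) (K : ℕ)
    (hK : ∀ u, K ≤ u → (transl M P).coeff u = 0) :
    pairing M q (transl M (pairing M p (transl M P))) =
      ∑ i ∈ Finset.range (M + 1), altChoose M i • ∑ r ∈ Finset.range K, ∑ u ∈ Finset.range K,
        hZ M (p + r - i) * (hZ M (q + i + u) * translCoeff M u (translCoeff M r P)) := by
  rw [pairing_eq_sum M p hK, map_sum, map_sum]
  simp only [Finset.smul_sum (r := altChoose M _)]
  rw [Finset.sum_comm]
  refine Finset.sum_congr rfl fun r _ => ?_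
  rw [map_mul, transl_hZ, Finset.sum_mul, map_sum]
  refine Finset.sum_congr rfl fun i _ => ?_
  -- Commuting the two translation coefficients lets the degree bound for P also serve for every
  -- coefficient of its translation.
  have h0 : ∀ u, K ≤ u → (transl M ((transl M P).coeff r)).coeff u = 0 := by
    intro u hu
    change (translCoeff M u * translCoeff M r) P = 0
    rw [(translCoeff_commute M u r).eq, Module.End.mul_apply, translCoeff_apply M u, hK u hu,
      map_zero]
  rw [smul_mul_assoc, pairing_smul, mul_assoc, mul_comm (Polynomial.X ^ i), pairing_C_mul,
    pairing_mul_X_pow, pairing_eq_sum M _ h0, Finset.mul_sum, Finset.smul_sum]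
  rfl

/-- In the expansion of the double action, i ↦ M - i exchanges the roles of s and t. The translation
coefficients commute and (1 - t)^M is symmetric up to (-1)^M. -/
theorem pairing_transl_comm (M : ℕ) (s t m : ℤ) (P : MvPolynomial ℕ+ ℂ) :
    pairing M (t - M * (m + 1)) (transl M (pairing M (s - M * m) (transl M P))) =
      (-1 : ℂ) ^ M •
        pairing M (s - M * (m + 1)) (transl M (pairing M (t - M * m) (transl M P))) := by
  have hK : ∀ u, (transl M P).natDegree + 1 ≤ u → (transl M P).coeff u = 0 :=
    fun u hu => Polynomial.coeff_eq_zero_of_natDegree_lt hu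
  rw [pairing_transl_pairing M _ _ P _ hK, pairing_transl_pairing M _ _ P _ hK,
    ← Finset.sum_range_reflect, Finset.smul_sum]
  refine Finset.sum_congr rfl fun i hi => ?_
  have hi' : i ≤ M := by
    rw [Finset.mem_range] at hi
    omega
  rw [Nat.add_sub_cancel, altChoose_sub hi', smul_smul, Finset.sum_comm]
  refine congrArg _ (Finset.sum_congr rfl fun u _ => Finset.sum_congr rfl fun r _ => ?_)
  rw [← Module.End.mul_apply, ← Module.End.mul_apply, (translCoeff_commute M u r).eq,
    mul_left_comm]
  have e1 : t - M * (m + 1) + ((M - i : ℕ) : ℤ) + u = t - M * m + u - i := by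
    push_cast [hi']; ring
  have e2 : s - M * m + r - ((M - i : ℕ) : ℤ) = s - M * (m + 1) + i + r := by
    push_cast [hi']; ring
  rw [e1, e2]

theorem vertexCoeff_mul_vertexCoeff (M : ℕ) (s t : ℤ) :
    vertexCoeff M t * vertexCoeff M s = (-1 : ℂ) ^ M • (vertexCoeff M s * vertexCoeff M t) := by
  refine Finsupp.lhom_ext fun m P => ?_
  have h1 := pairing_transl_comm M s t m P
  change vertexCoeff M t (vertexCoeff M s _) = (-1 : ℂ) ^ M • vertexCoeff M s (vertexCoeff M t _)
  rw [vertexCoeff_single, vertexCoeff_single, vertexCoeff_single, vertexCoeff_single,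
    Finsupp.smul_single, h1]

/-! ### Leading terms of monomials in the modes -/

/-- The product of the `h_p` over a list of indices. -/
def hprod (M : ℕ) (l : List ℤ) : MvPolynomial ℕ+ ℂ := (l.map (hZ M)).prod

theorem hprod_cons (M : ℕ) (p : ℤ) (l : List ℤ) : hprod M (p :: l) = hZ M p * hprod M l := by
  simp [hprod]

/-- The products of `h`'s obtained from `p :: l` by moving weight from `l` to `p`. -/
def raised (M : ℕ) (p : ℤ) (l : List ℤ) : Submodule ℂ (MvPolynomial ℕ+ ℂ) :=
  Submodule.span ℂ {f | ∃ (n : ℕ) (l' : List ℤ), 0 < n ∧ List.Forall₂ (· ≤ ·) l' l ∧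
    l'.sum + n = l.sum ∧ f = hprod M ((p + n) :: l')}

theorem forall₂_le_refl (l : List ℤ) : List.Forall₂ (· ≤ ·) l l :=
  List.forall₂_same.mpr fun _ _ => le_rfl

theorem mul_mem_raised (M : ℕ) (p a : ℤ) (i : ℕ) (l : List ℤ) {x : MvPolynomial ℕ+ ℂ}
    (hx : x ∈ raised M (p + i) l) : hZ M (a - i) * x ∈ raised M p (a :: l) := by
  induction hx using Submodule.span_induction with
  | mem x hx =>
    obtain ⟨n, l', hn, hl, hs, rfl⟩ := hx
    refine Submodule.subset_span ⟨i + n, (a - i) :: l', by omega,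
      List.Forall₂.cons (by omega) hl, ?_, ?_⟩
    · simp only [List.sum_cons, Nat.cast_add]; omega
    · rw [hprod_cons, hprod_cons, hprod_cons, mul_left_comm]
      push_cast
      rw [add_assoc]
  | zero => rw [mul_zero]; exact zero_mem _
  | add x y _ _ hx hy => rw [mul_add]; exact add_mem hx hy
  | smul c x _ hx => rw [mul_smul_comm]; exact Submodule.smul_mem _ c hx

/-- Translation replaces each factor h_a by a combination of the h_{a-i} y^i, and y^i raises the new
index p by i. The choice i = 0 in every factor has coefficient 1; all other choices move positive
weight to p. -/
theorem pairing_transl_hprod (M : ℕ) (p : ℤ) (l : List ℤ) :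
    pairing M p (transl M (hprod M l)) - hprod M (p :: l) ∈ raised M p l := by
  induction l generalizing p with
  | nil =>
    have : transl M (hprod M []) = Polynomial.monomial 0 1 := by simp [hprod]
    rw [this, pairing_monomial]
    simp [hprod]
  | cons a l ih =>
    have e : pairing M p (transl M (hprod M (a :: l))) = ∑ i ∈ Finset.range (M + 1),
        altChoose M i • (hZ M (a - i) * pairing M (p + i) (transl M (hprod M l))) := by
      rw [hprod_cons, map_mul, transl_hZ, Finset.sum_mul, map_sum]
      refine Finset.sum_congr rfl fun i _ => ?_
      rw [smul_mul_assoc, pairing_smul, mul_assoc, mul_comm (Polynomial.X ^ i), pairing_C_mul,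
        pairing_mul_X_pow]
    have h0 : altChoose M 0 = 1 := by simp [altChoose]
    rw [e, Finset.sum_range_succ', h0, one_smul, Nat.cast_zero, sub_zero, add_zero, add_sub_assoc]
    refine add_mem (Submodule.sum_mem _ fun i _ => Submodule.smul_mem _ _ ?_) ?_
    · rw [← sub_add_cancel (pairing M _ _) (hprod M ((p + (i + 1 : ℕ)) :: l)), mul_add]
      refine add_mem (mul_mem_raised M p a _ l (ih _)) ?_
      refine Submodule.subset_span ⟨i + 1, (a - (i + 1 : ℕ)) :: l, by omega,
        List.Forall₂.cons (by omega) (forall₂_le_refl l), ?_, ?_⟩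
      · simp only [List.sum_cons]; omega
      · rw [hprod_cons, hprod_cons, hprod_cons, mul_left_comm]
    · have := mul_mem_raised M p a 0 l (by simpa using ih p)
      rw [hprod_cons, hprod_cons, mul_left_comm, ← hprod_cons, ← mul_sub]
      simpa using this

/-- All suffix sums of the second list are at most those of the first one. -/
inductive SuffixLE : List ℤ → List ℤ → Prop
  | nil : SuffixLE [] []
  | cons {a b : ℤ} {l l' : List ℤ} : b + l'.sum ≤ a + l.sum → SuffixLE l l' →
      SuffixLE (a :: l) (b :: l')

theorem SuffixLE.refl (l : List ℤ) : SuffixLE l l := by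
  induction l with
  | nil => exact .nil
  | cons a l ih => exact .cons le_rfl ih

theorem SuffixLE.length_eq {l l' : List ℤ} (hl : SuffixLE l l') : l'.length = l.length := by
  induction hl with
  | nil => rfl
  | cons _ _ ih => simp [ih]

theorem SuffixLE.trans_forall₂ {l l' l'' : List ℤ} (hl : SuffixLE l l')
    (h' : List.Forall₂ (· ≤ ·) l'' l') : SuffixLE l l'' := by
  induction hl generalizing l'' with
  | nil => cases h'; exact .nil
  | cons hs _ ih =>
    cases h' with
    | cons hab ht =>
      have := ht.sum_le_sum
      exact .cons (by omega) (ih ht)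

/-- Induction combines b² ≥ a² + 2a(b - a) for the heads with the hypothesis for the tails at c = a.
The total `l'.sum - l.sum` is nonpositive and a ≤ c, so a may then be replaced by c. The free c
makes the induction run; for equal sums its term disappears. -/
theorem SuffixLE.sum_sq_le {l l' : List ℤ} (hl : SuffixLE l l') (hp : l.Pairwise (· ≥ ·))
    (c : ℤ) (hc : ∀ x ∈ l, x ≤ c) :
    (l.map (· ^ 2)).sum + 2 * c * (l'.sum - l.sum) ≤ (l'.map (· ^ 2)).sum ∧
    (l ≠ l' → (l.map (· ^ 2)).sum + 2 * c * (l'.sum - l.sum) < (l'.map (· ^ 2)).sum) := by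
  induction hl generalizing c with
  | nil => simp
  | @cons a b l l' hs _ ih =>
    rw [List.pairwise_cons] at hp
    obtain ⟨ih1, ih2⟩ := ih hp.2 a hp.1
    have hac : a ≤ c := hc a (by simp)
    simp only [List.map_cons, List.sum_cons]
    have h1 : 2 * c * (b + l'.sum - (a + l.sum)) ≤ 2 * a * (b + l'.sum - (a + l.sum)) := by
      nlinarith
    refine ⟨by nlinarith [sq_nonneg (b - a)], fun hne => ?_⟩
    by_cases hab : a = b
    · subst hab
      have := ih2 fun e => hne (by rw [e])
      nlinarith
    · have : 0 < (b - a) ^ 2 := by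
        have : b - a ≠ 0 := fun e => hab (by omega)
        positivity
      nlinarith

/-- The products of `h`'s dominating the one with index list `l`. -/
def dominating (M : ℕ) (l : List ℤ) : Submodule ℂ (MvPolynomial ℕ+ ℂ) :=
  Submodule.span ℂ {f | ∃ l' : List ℤ, SuffixLE l l' ∧ l'.sum = l.sum ∧ l ≠ l' ∧ f = hprod M l'}

theorem raised_le_dominating (M : ℕ) (p : ℤ) {l l' : List ℤ} (hl : SuffixLE l l')
    (hs : l'.sum = l.sum) : raised M p l' ≤ dominating M (p :: l) := by
  refine Submodule.span_le.mpr ?_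
  rintro f ⟨n, l'', hn, hl', hs', rfl⟩
  refine Submodule.subset_span ⟨_, .cons (by omega) (hl.trans_forall₂ hl'), ?_, ?_, rfl⟩
  · simp only [List.sum_cons]; omega
  · intro e
    have := (List.cons.inj e).1
    omega

/-- Involution exchanging lists of modes and lists of indices of the leading product of `h`'s. -/
def modeShift (M : ℕ) (b : ℤ) : List ℤ → List ℤ
  | [] => []
  | i :: l => (b - i - M * l.length) :: modeShift M b l

theorem length_modeShift (M : ℕ) (b : ℤ) (l : List ℤ) :
    (modeShift M b l).length = l.length := by
  induction l with
  | nil => rfl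
  | cons i l ih => simp [modeShift, ih]

theorem modeShift_modeShift (M : ℕ) (b : ℤ) (l : List ℤ) :
    modeShift M b (modeShift M b l) = l := by
  induction l with
  | nil => rfl
  | cons i l ih =>
    rw [modeShift, modeShift, ih, length_modeShift]
    congr 1
    ring

/-- A monomial in the modes applied to a highest weight vector is a leading product of `h`'s up to
dominating ones. -/
theorem modes_prod_vac (M : ℕ) (κ j : ℤ) (l : List ℤ) :
    ∃ P, (l.map fun i => vertexCoeff M (-i - κ)).prod (vac j) =
        Finsupp.single (j + l.length) P ∧
      P - hprod M (modeShift M (-κ - M * j) l) ∈ dominating M (modeShift M (-κ - M * j) l) := by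
  induction l with
  | nil => exact ⟨1, by simp [vac], by simp [hprod, modeShift]⟩
  | cons i l ih =>
    obtain ⟨P, hP, hd⟩ := ih
    set t := modeShift M (-κ - M * j) l with ht
    refine ⟨pairing M (-i - κ - M * (j + l.length)) (transl M P), ?_, ?_⟩
    · rw [List.map_cons, List.prod_cons, Module.End.mul_apply, hP, vertexCoeff_single]
      simp [add_assoc]
    · have hp : -i - κ - M * (j + l.length) = -κ - M * j - i - M * l.length := by ring
      rw [modeShift, hp, ← ht]
      set p := -κ - M * j - i - M * l.length
      -- Domination survives another mode, because transferring weight from the tail to the new head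
      -- only lowers the suffix sums of the tail.
      have hx : ∀ x ∈ dominating M t, pairing M p (transl M x) ∈ dominating M (p :: t) := by
        intro x hx
        induction hx using Submodule.span_induction with
        | mem x hx =>
          obtain ⟨l', hl, hs, hne, rfl⟩ := hx
          rw [← sub_add_cancel (pairing M _ _) (hprod M (p :: l'))]
          refine add_mem (raised_le_dominating M p hl hs (pairing_transl_hprod M p l'))
            (Submodule.subset_span ⟨_, .cons (by omega) hl, by simp [hs], ?_, rfl⟩)
          exact fun e => hne (List.cons.inj e).2
        | zero => rw [map_zero, map_zero]; exact zero_mem _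
        | add x y _ _ hx hy => rw [map_add, map_add]; exact add_mem hx hy
        | smul c x _ hx => rw [map_smul, pairing_smul]; exact Submodule.smul_mem _ c hx
      have e : pairing M p (transl M P) - hprod M (p :: t) =
          pairing M p (transl M (P - hprod M t)) +
            (pairing M p (transl M (hprod M t)) - hprod M (p :: t)) := by
        rw [map_sub, map_sub]; ring
      rw [e]
      exact add_mem (hx _ hd)
        (raised_le_dominating M p (SuffixLE.refl t) rfl (pairing_transl_hprod M p t))

/-! ### Algebraic independence of the h's -/

/-- The algebra endomorphism `x_n ↦ h_n`. -/
def hMap (M : ℕ) : MvPolynomial ℕ+ ℂ →ₐ[ℂ] MvPolynomial ℕ+ ℂ :=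
  MvPolynomial.aeval fun n => h M n

/-- Power sums are recovered from complete symmetric functions by a logarithmic derivative. With S =
1 + ∑ x_n Xⁿ, send √M x_n to the coefficient of Xⁿ in X S'/S; the image of the generating series of
the h's then solves the same equation as S, so h_n is sent to x_n. -/
theorem exists_leftInverse_hMap {M : ℕ} (hM : 0 < M) :
    ∃ g : MvPolynomial ℕ+ ℂ →ₐ[ℂ] MvPolynomial ℕ+ ℂ, g.comp (hMap M) = AlgHom.id ℂ _ := by
  let S : PowerSeries (MvPolynomial ℕ+ ℂ) := 1 + PowerSeries.mk xvar
  have hS0 : PowerSeries.constantCoeff S = ((1 : (MvPolynomial ℕ+ ℂ)ˣ) : MvPolynomial ℕ+ ℂ) := by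
    rw [← PowerSeries.coeff_zero_eq_constantCoeff_apply]
    simp only [S, map_add, PowerSeries.coeff_zero_one, PowerSeries.coeff_mk, xvar, add_zero,
      Units.val_one]
  let B := eulerDeriv S * PowerSeries.invOfUnit S 1
  have hB : IsExpPrimitive B S := by
    refine ⟨by simpa using hS0, ?_⟩
    rw [mul_assoc, mul_comm _ S, PowerSeries.mul_invOfUnit S 1 hS0, mul_one]
  have hB0 : PowerSeries.coeff 0 B = 0 := by
    simp [B, PowerSeries.coeff_mul]
  let g : MvPolynomial ℕ+ ℂ →ₐ[ℂ] MvPolynomial ℕ+ ℂ :=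
    MvPolynomial.aeval fun n : ℕ+ => (root M)⁻¹ • PowerSeries.coeff (n : ℕ) B
  have h1 := (isExpPrimitive_h M).map g.toRingHom
  have h2 : PowerSeries.map g.toRingHom (PowerSeries.mk fun k => root M • xvar k) = B := by
    ext1 k
    rw [PowerSeries.coeff_map, PowerSeries.coeff_mk]
    change g (root M • xvar k) = _
    cases k with
    | zero => rw [xvar, smul_zero, map_zero, hB0]
    | succ n =>
      rw [map_smul, xvar, MvPolynomial.aeval_X, smul_smul, mul_inv_cancel₀ (root_ne_zero hM),
        one_smul]
      rfl
  rw [h2] at h1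
  refine ⟨g, ?_⟩
  ext1 n
  have h3 := congrArg (PowerSeries.coeff (n : ℕ)) (h1.ext hB0 hB)
  rw [PowerSeries.coeff_map, PowerSeries.coeff_mk] at h3
  rw [AlgHom.comp_apply, hMap, MvPolynomial.aeval_X]
  refine Eq.trans h3 ?_
  obtain ⟨k, hk⟩ := Nat.exists_eq_succ_of_ne_zero n.ne_zero
  have hn : n = k.succPNat := PNat.eq hk
  subst hn
  simp [S, PowerSeries.coeff_one, xvar]

theorem hMap_injective {M : ℕ} (hM : 0 < M) : Function.Injective (hMap M) := by
  obtain ⟨g, hg⟩ := exists_leftInverse_hMap hM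
  exact Function.LeftInverse.injective fun x => DFunLike.congr_fun hg x

/-- The exponent vector of the variable `x_k`, and `0` for `k = 0`. -/
def partVec : ℕ → ℕ+ →₀ ℕ
  | 0 => 0
  | n + 1 => Finsupp.single n.succPNat 1

theorem partVec_apply (k : ℕ) (n : ℕ+) : partVec k n = if (n : ℕ) = k then 1 else 0 := by
  cases k with
  | zero => simp [partVec]
  | succ k =>
    rw [partVec, Finsupp.single_apply]
    refine if_congr ?_ rfl rfl
    rw [← PNat.coe_inj, eq_comm]
    rfl

/-- The exponent vector of a multiset of natural numbers, forgetting zeros. -/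
def expo (m : Multiset ℕ) : ℕ+ →₀ ℕ := (m.map partVec).sum

theorem expo_cons (k : ℕ) (m : Multiset ℕ) : expo (k ::ₘ m) = partVec k + expo m := by
  simp [expo]

theorem expo_apply (m : Multiset ℕ) (n : ℕ+) : expo m n = m.count (n : ℕ) := by
  induction m using Multiset.induction_on with
  | empty => simp [expo]
  | cons k m ih =>
    rw [expo_cons, Finsupp.add_apply, ih, Multiset.count_cons, add_comm, partVec_apply]

/-- The exponent vector gives all positive multiplicities, and the cardinality then gives the
multiplicity of 0. This is why the lattice degree can separate products that differ only by factors
h_0 = 1. -/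
theorem eq_of_expo_eq {m m' : Multiset ℕ} (hc : m.card = m'.card) (he : expo m = expo m') :
    m = m' := by
  have hf : m.filter (0 < ·) = m'.filter (0 < ·) := by
    ext k
    by_cases hk : 0 < k
    · have := DFunLike.congr_fun he (k.toPNat hk)
      rw [expo_apply, expo_apply] at this
      rw [Multiset.count_filter, Multiset.count_filter, if_pos hk, if_pos hk]
      exact this
    · rw [Multiset.count_filter, Multiset.count_filter, if_neg hk, if_neg hk]
  have hz : ∀ m : Multiset ℕ, m.filter (fun k => ¬ 0 < k) =
      Multiset.replicate (m.card - (m.filter (0 < ·)).card) 0 := by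
    intro m
    rw [Multiset.eq_replicate]
    constructor
    · have := congrArg Multiset.card (Multiset.filter_add_not (0 < ·) m)
      rw [Multiset.card_add] at this
      omega
    · intro k hk
      have := (Multiset.mem_filter.mp hk).2
      omega
  rw [← Multiset.filter_add_not (0 < ·) m, ← Multiset.filter_add_not (0 < ·) m', hz, hz, hf, hc]

/-- The product of the `h_k` over a multiset, as a vector of the summand which is reached from
the `j`-th one by as many vertex operators as the multiset has elements. -/
def hVec (M : ℕ) (j : ℤ) (m : Multiset ℕ) : LatticeSpace :=
  Finsupp.single (j + m.card) (m.map (h M)).prod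

theorem hMap_monomial_expo (M : ℕ) (m : Multiset ℕ) :
    hMap M (MvPolynomial.monomial (expo m) 1) = (m.map (h M)).prod := by
  induction m using Multiset.induction_on with
  | empty => simp [expo]
  | cons k m ih =>
    rw [expo_cons, ← one_mul (1 : ℂ), ← MvPolynomial.monomial_mul, map_mul, ih, Multiset.map_cons,
      Multiset.prod_cons]
    congr 1
    cases k with
    | zero => simp [partVec, h_zero]
    | succ n => exact MvPolynomial.aeval_X _ _

theorem linearIndependent_hVec {M : ℕ} (hM : 0 < M) (j : ℤ) :
    LinearIndependent ℂ (hVec M j) := by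
  let b := Finsupp.basis (R := ℂ) (ι := ℤ) fun _ => MvPolynomial.basisMonomials ℕ+ ℂ
  let g : Multiset ℕ → (Σ _ : ℤ, ℕ+ →₀ ℕ) := fun m => ⟨j + m.card, expo m⟩
  have hg : Function.Injective g := by
    intro m m' hmm
    simp only [g, Sigma.mk.injEq] at hmm
    exact eq_of_expo_eq (by omega) (eq_of_heq hmm.2)
  have h1 := b.linearIndependent.comp g hg
  have h2 := h1.map' (Finsupp.mapRange.linearMap (hMap M).toLinearMap)
    (LinearMap.ker_eq_bot.mpr (Finsupp.mapRange_injective _ (map_zero _) (hMap_injective hM)))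
  have e : hVec M j = Finsupp.mapRange.linearMap (hMap M).toLinearMap ∘ b ∘ g := by
    funext m
    simp only [Function.comp_apply, b, g, Finsupp.coe_basis, MvPolynomial.coe_basisMonomials]
    rw [hVec, ← hMap_monomial_expo]
    simp
  rw [e]
  exact h2

/-! ### Unitriangular families -/

section Triangular

variable {I V : Type*} [AddCommGroup V] [Module ℂ V] {B F : I → V} {Q : I → ℕ} {c : I → ℕ}

theorem linearIndependent_of_triangular (hB : LinearIndependent ℂ B)
    (hF : ∀ i, F i - B i ∈ Submodule.span ℂ (B '' {k | Q i < Q k ∧ c k = c i})) :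
    LinearIndependent ℂ F := by
  have hd : ∀ i, ∃ d ∈ Finsupp.supported ℂ ℂ {k | Q i < Q k ∧ c k = c i},
      Finsupp.linearCombination ℂ B d = F i - B i := fun i =>
    (Finsupp.mem_span_image_iff_linearCombination ℂ).mp (hF i)
  choose d hd hdF using hd
  have e : F = Finsupp.linearCombination ℂ B ∘ fun i => Finsupp.single i 1 + d i := by
    funext i
    simp [hdF]
  rw [e]
  refine LinearIndependent.map' ?_ _ (LinearMap.ker_eq_bot.mpr hB)
  rw [linearIndependent_iff]
  intro l hl
  by_contra hne
  -- At an index of minimal Q no other term of the relation contributes, since corrections have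
  -- strictly larger Q.
  obtain ⟨i, hi, hmin⟩ := l.support.exists_min_image Q (Finsupp.support_nonempty_iff.mpr hne)
  refine Finsupp.mem_support_iff.mp hi ?_
  have h1 := DFunLike.congr_fun hl i
  rw [Finsupp.linearCombination_apply, Finsupp.sum, Finsupp.finsetSum_apply,
    Finset.sum_eq_single_of_mem i hi] at h1
  · have h0 : d i i = 0 := by
      by_contra h
      have := (Finsupp.mem_supported ℂ (d i)).mp (hd i) (Finsupp.mem_support_iff.mpr h)
      exact lt_irrefl _ this.1
    simpa [h0] using h1
  · intro k hk hki
    have h0 : d k i = 0 := by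
      by_contra h
      have := (Finsupp.mem_supported ℂ (d k)).mp (hd k) (Finsupp.mem_support_iff.mpr h)
      exact absurd (hmin k hk) (not_le.mpr this.1)
    simp [h0, hki]

theorem span_le_span_of_triangular (hQ : ∀ i, Q i ≤ c i ^ 2)
    (hF : ∀ i, F i - B i ∈ Submodule.span ℂ (B '' {k | Q i < Q k ∧ c k = c i})) :
    Submodule.span ℂ (Set.range B) ≤ Submodule.span ℂ (Set.range F) := by
  -- Corrections keep c and increase Q, which is bounded by c², so c² - Q is a decreasing measure.
  have key : ∀ n i, c i ^ 2 - Q i = n → B i ∈ Submodule.span ℂ (Set.range F) := by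
    intro n
    induction n using Nat.strong_induction_on with
    | _ n ih =>
      intro i hi
      rw [← sub_sub_cancel (F i) (B i)]
      refine sub_mem (Submodule.subset_span ⟨i, rfl⟩) (Submodule.span_le.mpr ?_ (hF i))
      rintro _ ⟨k, ⟨hk, hck⟩, rfl⟩
      have h1 := hQ k
      rw [hck] at h1
      exact ih _ (by rw [hck]; omega) k rfl
  refine Submodule.span_le.mpr ?_
  rintro _ ⟨i, rfl⟩
  exact key _ i rfl

end Triangular

/-! ### The basic subspace lies in the span of products of h's -/

/-- The multiset of the nonnegative parts of the entries of a list. -/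
def toMultiset (l : List ℤ) : Multiset ℕ := ((l.map Int.toNat : List ℕ) : Multiset ℕ)

theorem hprod_eq (M : ℕ) {l : List ℤ} (hl : ∀ x ∈ l, 0 ≤ x) :
    hprod M l = ((toMultiset l).map (h M)).prod := by
  rw [toMultiset, Multiset.map_coe, Multiset.prod_coe, hprod, List.map_map]
  congr 1
  refine List.map_congr_left fun x hx => ?_
  rw [Function.comp_apply, hZ, if_pos (hl x hx)]

theorem hprod_eq_zero (M : ℕ) {l : List ℤ} (hl : ¬ ∀ x ∈ l, 0 ≤ x) : hprod M l = 0 := by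
  push Not at hl
  obtain ⟨x, hx, hx0⟩ := hl
  exact List.prod_eq_zero (List.mem_map.mpr ⟨x, hx, hZ_of_neg M hx0⟩)

theorem card_toMultiset (l : List ℤ) : (toMultiset l).card = l.length := by
  simp [toMultiset]

theorem map_cast_toNat {l : List ℤ} (hl : ∀ x ∈ l, 0 ≤ x) :
    (l.map Int.toNat).map (Nat.cast : ℕ → ℤ) = l := by
  rw [List.map_map]
  refine (List.map_congr_left fun x hx => ?_).trans (List.map_id l)
  exact Int.toNat_of_nonneg (hl x hx)

theorem sum_toMultiset {l : List ℤ} (hl : ∀ x ∈ l, 0 ≤ x) :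
    ((toMultiset l).sum : ℤ) = l.sum := by
  conv_rhs => rw [← map_cast_toNat hl]
  rw [toMultiset, Multiset.sum_coe, Nat.cast_list_sum]

theorem SuffixLE.sum_sq_lt {l l' : List ℤ} (hl : SuffixLE l l') (hp : l.Pairwise (· ≥ ·))
    (hs : l'.sum = l.sum) (hne : l ≠ l') : (l.map (· ^ 2)).sum < (l'.map (· ^ 2)).sum := by
  cases l with
  | nil => cases hl; exact absurd rfl hne
  | cons a l =>
    have hc : ∀ x ∈ a :: l, x ≤ a := by
      intro x hx
      rcases List.mem_cons.mp hx with rfl | hx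
      · exact le_rfl
      · exact (List.pairwise_cons.mp hp).1 x hx
    have := (hl.sum_sq_le hp a hc).2 hne
    rwa [hs, sub_self, mul_zero, add_zero] at this

/-- The sum of squares of the elements of a multiset. -/
def sumSq (m : Multiset ℕ) : ℕ := (m.map (· ^ 2)).sum

theorem sumSq_le (m : Multiset ℕ) : sumSq m ≤ m.sum ^ 2 := by
  induction m using Multiset.induction_on with
  | empty => simp [sumSq]
  | cons a m ih =>
    have : sumSq (a ::ₘ m) = a ^ 2 + sumSq m := by simp [sumSq]
    rw [this, Multiset.sum_cons]
    nlinarith [Nat.zero_le (a * m.sum)]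

theorem sumSq_toMultiset {l : List ℤ} (hl : ∀ x ∈ l, 0 ≤ x) :
    (sumSq (toMultiset l) : ℤ) = (l.map (· ^ 2)).sum := by
  conv_rhs => rw [← map_cast_toNat hl]
  rw [sumSq, toMultiset, Multiset.map_coe, Multiset.sum_coe, Nat.cast_list_sum, List.map_map,
    List.map_map (f := (Nat.cast : ℕ → ℤ))]
  exact congrArg List.sum (List.map_congr_left fun x _ => by simp)

theorem single_hprod_mem_span (M : ℕ) (j : ℤ) (l : List ℤ) :
    Finsupp.single (j + l.length) (hprod M l) ∈ Submodule.span ℂ (Set.range (hVec M j)) := by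
  by_cases hl : ∀ x ∈ l, 0 ≤ x
  · refine Submodule.subset_span ⟨toMultiset l, ?_⟩
    rw [hVec, card_toMultiset, hprod_eq M hl]
  · rw [hprod_eq_zero M hl, Finsupp.single_zero]
    exact zero_mem _

/-- A mode turns a product of h's into a combination of products with one more factor, while the
summand moves up by one. Products with a negative index vanish, so nothing leaves the span. -/
theorem vertexCoeff_mem_span (M : ℕ) (j s : ℤ) {w : LatticeSpace}
    (hw : w ∈ Submodule.span ℂ (Set.range (hVec M j))) :
    vertexCoeff M s w ∈ Submodule.span ℂ (Set.range (hVec M j)) := by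
  induction hw using Submodule.span_induction with
  | zero => rw [map_zero]; exact zero_mem _
  | add x y _ _ hx hy => rw [map_add]; exact add_mem hx hy
  | smul c x _ hx => rw [map_smul]; exact Submodule.smul_mem _ c hx
  | mem x hx =>
    obtain ⟨m, rfl⟩ := hx
    obtain ⟨l, rfl⟩ : ∃ l : List ℕ, (l : Multiset ℕ) = m := ⟨m.toList, m.coe_toList⟩
    have hl : ((l : Multiset ℕ).map (h M)).prod = hprod M (l.map (Nat.cast : ℕ → ℤ)) := by
      rw [Multiset.map_coe, Multiset.prod_coe, hprod, List.map_map]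
      exact congrArg List.prod (List.map_congr_left fun x _ => (hZ_natCast M x).symm)
    rw [hVec, vertexCoeff_single, hl, ← sub_add_cancel (pairing M _ _) (hprod M (_ :: _)),
      Finsupp.single_add]
    refine add_mem ?_ ?_
    · have := pairing_transl_hprod M (s - M * (j + (l : Multiset ℕ).card))
        (l.map (Nat.cast : ℕ → ℤ))
      refine (Submodule.span_le (p := (Submodule.span ℂ (Set.range (hVec M j))).comap
        (Finsupp.lsingle (j + (l : Multiset ℕ).card + 1)))).mpr ?_ this
      rintro _ ⟨n, l', _, hl', _, rfl⟩
      have h1 := single_hprod_mem_span M j ((s - M * (j + (l : Multiset ℕ).card) + n) :: l')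
      rw [List.length_cons, hl'.length_eq, List.length_map] at h1
      simpa [add_assoc] using h1
    · have h1 := single_hprod_mem_span M j
        ((s - M * (j + (l : Multiset ℕ).card)) :: l.map (Nat.cast : ℕ → ℤ))
      simpa [add_assoc] using h1

theorem basicSubspace_le (M : ℕ) (κ j : ℤ) :
    basicSubspace (fun n => vertexCoeff M (-n - κ)) j ≤
      Submodule.span ℂ (Set.range (hVec M j)) := by
  rintro _ ⟨T, hT, rfl⟩
  have hstab : ∀ w ∈ Submodule.span ℂ (Set.range (hVec M j)),
      T w ∈ Submodule.span ℂ (Set.range (hVec M j)) := by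
    induction hT using Algebra.adjoin_induction with
    | mem x hx =>
      obtain ⟨n, rfl⟩ := hx
      exact fun w hw => vertexCoeff_mem_span M j _ hw
    | algebraMap r =>
      intro w hw
      rw [Module.algebraMap_end_apply]
      exact Submodule.smul_mem _ r hw
    | add x y _ _ hx hy => exact fun w hw => add_mem (hx w hw) (hy w hw)
    | mul x y _ _ hx hy => exact fun w hw => hx _ (hy w hw)
  refine hstab _ (Submodule.subset_span ⟨0, ?_⟩)
  simp [hVec, vac]

/-! ### Fibonacci index sets and multisets -/

theorem modeShift_nonneg (M : ℕ) (b : ℤ) {L : List ℤ} (hp : L.Pairwise fun (i k : ℤ) => i + M ≤ k)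
    (hb : ∀ i ∈ L, i ≤ b) : ∀ x ∈ modeShift M b L, 0 ≤ x := by
  induction L with
  | nil => simp [modeShift]
  | cons i L ih =>
    rw [List.pairwise_cons] at hp
    have hb' : ∀ k ∈ L, k ≤ b := fun k hk => hb k (List.mem_cons_of_mem _ hk)
    have ih := ih hp.2 hb'
    rw [modeShift]
    intro x hx
    rcases List.mem_cons.mp hx with rfl | hx
    · cases L with
      | nil => have := hb i (by simp); simp; omega
      | cons k L =>
        have h1 := ih _ (List.mem_cons_self)
        have h2 := hp.1 k (by simp)
        simp only [List.length_cons, Nat.cast_add, Nat.cast_one]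
        linarith
    · exact ih x hx

theorem modeShift_le (M : ℕ) (b c : ℤ) {L : List ℤ} (hp : L.Pairwise fun (i k : ℤ) => i + M ≤ k)
    (hc : ∀ k ∈ L, c + M ≤ k) : ∀ x ∈ modeShift M b L, x ≤ b - c - M * L.length := by
  induction L generalizing c with
  | nil => simp [modeShift]
  | cons i L ih =>
    rw [List.pairwise_cons] at hp
    have h1 := hc i (by simp)
    rw [modeShift]
    intro x hx
    simp only [List.length_cons, Nat.cast_add, Nat.cast_one]
    rcases List.mem_cons.mp hx with rfl | hx
    · linarith
    · have := ih i hp.2 hp.1 x hx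
      have : (0 : ℤ) ≤ M := Nat.cast_nonneg M
      linarith

theorem pairwise_modeShift (M : ℕ) (b : ℤ) {L : List ℤ}
    (hp : L.Pairwise fun (i k : ℤ) => i + M ≤ k) : (modeShift M b L).Pairwise (· ≥ ·) := by
  induction L with
  | nil => simp [modeShift]
  | cons i L ih =>
    rw [List.pairwise_cons] at hp
    rw [modeShift, List.pairwise_cons]
    exact ⟨modeShift_le M b i hp.2 hp.1, ih hp.2⟩

theorem le_modeShift (M : ℕ) (b c : ℤ) {t : List ℤ} (hp : t.Pairwise (· ≥ ·))
    (hc : ∀ x ∈ t, x ≤ c) : ∀ k ∈ modeShift M b t, b - c - M * t.length + M ≤ k := by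
  induction t generalizing c with
  | nil => simp [modeShift]
  | cons y t ih =>
    rw [List.pairwise_cons] at hp
    have h1 := hc y (by simp)
    rw [modeShift]
    intro k hk
    simp only [List.length_cons, Nat.cast_add, Nat.cast_one]
    rcases List.mem_cons.mp hk with rfl | hk
    · linarith
    · have := ih y hp.2 hp.1 k hk
      have : (0 : ℤ) ≤ M := Nat.cast_nonneg M
      linarith

theorem pairwise_modeShift_of_pairwise (M : ℕ) (b : ℤ) {t : List ℤ} (hp : t.Pairwise (· ≥ ·)) :
    (modeShift M b t).Pairwise fun (i k : ℤ) => i + M ≤ k := by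
  induction t with
  | nil => simp [modeShift]
  | cons y t ih =>
    rw [List.pairwise_cons] at hp
    rw [modeShift, List.pairwise_cons]
    exact ⟨le_modeShift M b y hp.2 hp.1, ih hp.2⟩

theorem modeShift_le_bound (M : ℕ) (b : ℤ) {t : List ℤ} (h0 : ∀ x ∈ t, 0 ≤ x) :
    ∀ k ∈ modeShift M b t, k ≤ b := by
  induction t with
  | nil => simp [modeShift]
  | cons y t ih =>
    rw [modeShift]
    intro k hk
    rcases List.mem_cons.mp hk with rfl | hk
    · have := h0 y (by simp)
      have : (0 : ℤ) ≤ M * t.length := by positivity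
      omega
    · exact ih (fun x hx => h0 x (List.mem_cons_of_mem _ hx)) k hk

/-- The multiset of indices of the leading product of `h`'s of the monomial in the modes with
index set `s`. -/
def leading (M : ℕ) (b : ℤ) (s : Finset ℤ) : Multiset ℕ := toMultiset (modeShift M b s.sort)

theorem IsFib.pairwise_sort {M : ℕ} (hM : 0 < M) {b : ℤ} {s : Finset ℤ}
    (hs : IsFib (M - 1) b s) : s.sort.Pairwise fun (i k : ℤ) => i + M ≤ k := by
  refine List.Pairwise.imp_of_mem (fun {i k} hi hk hik => ?_) s.sortedLT_sort.pairwise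
  have := hs.2 i ((Finset.mem_sort _).mp hi) k ((Finset.mem_sort _).mp hk) hik
  omega

theorem IsFib.modeShift_nonneg {M : ℕ} (hM : 0 < M) {b : ℤ} {s : Finset ℤ}
    (hs : IsFib (M - 1) b s) : ∀ x ∈ modeShift M b s.sort, 0 ≤ x :=
  LatticeVOA.modeShift_nonneg M b (hs.pairwise_sort hM)
    fun i hi => hs.1 i ((Finset.mem_sort _).mp hi)

/-- A weakly decreasing list is determined by its multiset, and `modeShift` is an involution, so the
sorted index list is recovered. -/
theorem leading_injOn {M : ℕ} (hM : 0 < M) (b : ℤ) :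
    Set.InjOn (leading M b) {s | IsFib (M - 1) b s} := by
  intro s hs s' hs' e
  have hp : (modeShift M b s.sort).Perm (modeShift M b s'.sort) := by
    rw [← map_cast_toNat (hs.modeShift_nonneg hM), ← map_cast_toNat (hs'.modeShift_nonneg hM)]
    exact (Multiset.coe_eq_coe.mp e).map _
  have h1 := hp.eq_of_pairwise' (pairwise_modeShift M b (hs.pairwise_sort hM))
    (pairwise_modeShift M b (hs'.pairwise_sort hM))
  have h2 := congrArg (modeShift M b) h1
  rw [modeShift_modeShift, modeShift_modeShift] at h2
  rw [← s.sort_toFinset (· ≤ ·), h2, s'.sort_toFinset]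

theorem exists_leading_eq {M : ℕ} (hM : 0 < M) (b : ℤ) (m : Multiset ℕ) :
    ∃ s, IsFib (M - 1) b s ∧ leading M b s = m := by
  set t : List ℤ := (m.sort (· ≥ ·)).map Nat.cast with ht
  have hp : t.Pairwise (· ≥ ·) :=
    List.pairwise_map.mpr ((m.pairwise_sort (· ≥ ·)).imp fun h => by simpa using h)
  have h0 : ∀ x ∈ t, 0 ≤ x := by
    intro x hx
    obtain ⟨n, _, rfl⟩ := List.mem_map.mp hx
    exact Int.natCast_nonneg n
  have hL := pairwise_modeShift_of_pairwise M b hp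
  have hlt : (modeShift M b t).Pairwise (· < ·) := hL.imp fun h => by omega
  have hsort : (modeShift M b t).toFinset.sort = modeShift M b t :=
    (List.toFinset_sort (· ≤ ·) hlt.nodup).mpr (hlt.imp fun h => h.le)
  refine ⟨(modeShift M b t).toFinset, ⟨fun i hi => ?_, fun i hi k hk hik => ?_⟩, ?_⟩
  · exact modeShift_le_bound M b h0 i (List.mem_toFinset.mp hi)
  · have h1 : (modeShift M b t).Pairwise fun (i k : ℤ) => i < k → i + M ≤ k := by
      refine hL.imp ?_
      exact fun h _ => h
    -- The list is increasing, so for pairs taken in the opposite order the premise fails.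
    have h2 : (modeShift M b t).Pairwise (flip fun (i k : ℤ) => i < k → i + M ≤ k) :=
      hL.imp fun {x y} h h' => absurd (show y < x from h') (by omega)
    have := h1.forall_of_forall_of_flip (fun x _ h => absurd h (lt_irrefl x)) h2
      (List.mem_toFinset.mp hi) (List.mem_toFinset.mp hk) hik
    omega
  · rw [leading, hsort, modeShift_modeShift, toMultiset, ht, List.map_map]
    have : Int.toNat ∘ (Nat.cast : ℕ → ℤ) = id := by funext n; simp
    rw [this, List.map_id, Multiset.sort_eq]

/-- Fibonacci index sets correspond to multisets of natural numbers. -/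
def fibEquiv {M : ℕ} (hM : 0 < M) (b : ℤ) : {s // IsFib (M - 1) b s} ≃ Multiset ℕ :=
  Equiv.ofBijective (fun s => leading M b s)
    ⟨fun s s' e => Subtype.ext (leading_injOn hM b s.2 s'.2 e), fun m => by
      obtain ⟨s, hs, e⟩ := exists_leading_eq hM b m
      exact ⟨⟨s, hs⟩, e⟩⟩

/-! ### Fibonacci vectors form a basis -/

/-- The monomial in the modes with index set `s`, applied to the highest weight vector. -/
def fibVec (M : ℕ) (κ j : ℤ) (s : Finset ℤ) : LatticeSpace :=
  (s.sort.map fun i => vertexCoeff M (-i - κ)).prod (vac j)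

/-- The correction terms dominate a weakly decreasing list with the same sum, so their sums of
squares are strictly larger; those with a negative index are zero. -/
theorem fibVec_sub_mem {M : ℕ} (hM : 0 < M) (κ j : ℤ) {s : Finset ℤ}
    (hs : IsFib (M - 1) (-κ - M * j) s) :
    fibVec M κ j s - hVec M j (leading M (-κ - M * j) s) ∈ Submodule.span ℂ (hVec M j ''
      {m | sumSq (leading M (-κ - M * j) s) < sumSq m ∧
        m.sum = (leading M (-κ - M * j) s).sum}) := by
  obtain ⟨P, hP, hd⟩ := modes_prod_vac M κ j s.sort
  have h0 := hs.modeShift_nonneg hM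
  have hpw := pairwise_modeShift M (-κ - M * j) (hs.pairwise_sort hM)
  have hlen := length_modeShift M (-κ - M * j) s.sort
  set t := modeShift M (-κ - M * j) s.sort with ht
  have e : hVec M j (leading M (-κ - M * j) s) =
      Finsupp.single (j + s.sort.length) (hprod M t) := by
    rw [hVec, leading, card_toMultiset, ← ht, hlen, hprod_eq M h0]
  rw [fibVec, hP, e, ← Finsupp.single_sub]
  refine (Submodule.span_le (p := (Submodule.span ℂ _).comap
        (Finsupp.lsingle (j + s.sort.length)))).mpr ?_ hd
  rintro _ ⟨l', hl, hsum, hne, rfl⟩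
  by_cases h0' : ∀ x ∈ l', 0 ≤ x
  · refine Submodule.subset_span ⟨toMultiset l', ⟨?_, ?_⟩, ?_⟩
    · have := hl.sum_sq_lt hpw hsum hne
      rw [← sumSq_toMultiset h0, ← sumSq_toMultiset h0'] at this
      exact_mod_cast this
    · have : ((toMultiset l').sum : ℤ) = (toMultiset t).sum := by
        rw [sum_toMultiset h0', sum_toMultiset h0, hsum]
      exact_mod_cast this
    · rw [hVec, card_toMultiset, hl.length_eq, hlen, hprod_eq M h0']
      rfl
  · rw [hprod_eq_zero M h0']
    exact zero_mem _

theorem fibVec_sub_mem_subtype {M : ℕ} (hM : 0 < M) (κ j : ℤ)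
    (s : {s // IsFib (M - 1) (-κ - M * j) s}) :
    fibVec M κ j s - (hVec M j ∘ fibEquiv hM (-κ - M * j)) s ∈
      Submodule.span ℂ ((hVec M j ∘ fibEquiv hM (-κ - M * j)) ''
        {s' | sumSq (fibEquiv hM (-κ - M * j) s) < sumSq (fibEquiv hM (-κ - M * j) s') ∧
          (fibEquiv hM (-κ - M * j) s').sum = (fibEquiv hM (-κ - M * j) s).sum}) := by
  refine Submodule.span_mono ?_ (fibVec_sub_mem hM κ j s.2)
  rintro _ ⟨m, hm, rfl⟩
  refine ⟨(fibEquiv hM _).symm m, ?_, by simp⟩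
  rw [Set.mem_ofPred_eq, Equiv.apply_symm_apply]
  exact hm

theorem linearIndependent_fibVec {M : ℕ} (hM : 0 < M) (κ j : ℤ) :
    LinearIndependent ℂ fun s : {s // IsFib (M - 1) (-κ - M * j) s} => fibVec M κ j s :=
  linearIndependent_of_triangular ((linearIndependent_hVec hM j).comp _ (Equiv.injective _))
    (fibVec_sub_mem_subtype hM κ j)

theorem fibVec_mem_basicSubspace (M : ℕ) (κ j : ℤ) (s : Finset ℤ) :
    fibVec M κ j s ∈ basicSubspace (fun n => vertexCoeff M (-n - κ)) j := by
  refine ⟨_, (Subalgebra.mem_toSubmodule _).mpr (list_prod_mem fun T hT => ?_), rfl⟩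
  obtain ⟨i, _, rfl⟩ := List.mem_map.mp hT
  exact Algebra.subset_adjoin ⟨i, rfl⟩

theorem span_hVec_le {M : ℕ} (hM : 0 < M) (κ j : ℤ) :
    Submodule.span ℂ (Set.range (hVec M j)) ≤ Submodule.span ℂ
      (Set.range fun s : {s // IsFib (M - 1) (-κ - M * j) s} => fibVec M κ j s) := by
  have h1 := span_le_span_of_triangular (fun s => sumSq_le (fibEquiv hM (-κ - M * j) s))
    (fibVec_sub_mem_subtype hM κ j)
  rwa [(fibEquiv hM (-κ - M * j)).surjective.range_comp] at h1

theorem span_fibVec_le (M : ℕ) (κ j : ℤ) :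
    Submodule.span ℂ (Set.range fun s : {s // IsFib (M - 1) (-κ - M * j) s} => fibVec M κ j s) ≤
      basicSubspace (fun n => vertexCoeff M (-n - κ)) j := by
  refine Submodule.span_le.mpr ?_
  rintro _ ⟨s, rfl⟩
  exact fibVec_mem_basicSubspace M κ j s

theorem span_fibVec {M : ℕ} (hM : 0 < M) (κ j : ℤ) :
    Submodule.span ℂ (Set.range fun s : {s // IsFib (M - 1) (-κ - M * j) s} => fibVec M κ j s) =
      basicSubspace (fun n => vertexCoeff M (-n - κ)) j :=
  (span_fibVec_le M κ j).antisymm ((basicSubspace_le M κ j).trans (span_hVec_le hM κ j))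

/-- Three inclusions form a cycle: basic subspace, products of h's, Fibonacci vectors, basic
subspace. -/
theorem basicSubspace_eq {M : ℕ} (hM : 0 < M) (κ j : ℤ) :
    basicSubspace (fun n => vertexCoeff M (-n - κ)) j =
      Submodule.span ℂ (Set.range (hVec M j)) :=
  (basicSubspace_le M κ j).antisymm ((span_hVec_le hM κ j).trans (span_fibVec_le M κ j))

/-! ### Eigenvalues of a_0 and L_0 -/

theorem isWeightedHomogeneous_xvar (k : ℕ) :
    MvPolynomial.IsWeightedHomogeneous (fun n : ℕ+ => (n : ℕ)) (xvar k) k := by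
  cases k with
  | zero => exact MvPolynomial.isWeightedHomogeneous_zero ℂ _ _
  | succ n => exact MvPolynomial.isWeightedHomogeneous_X ℂ _ _

theorem isWeightedHomogeneous_h (M n : ℕ) :
    MvPolynomial.IsWeightedHomogeneous (fun n : ℕ+ => (n : ℕ)) (h M n) n := by
  induction n using Nat.strong_induction_on with
  | _ n ih =>
    cases n with
    | zero => rw [h_zero]; exact MvPolynomial.isWeightedHomogeneous_one ℂ _
    | succ n =>
      rw [h, newton, ← MvPolynomial.mem_weightedHomogeneousSubmodule]
      refine Submodule.smul_mem _ _ (Submodule.sum_mem _ fun i _ => ?_)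
      rw [smul_mul_assoc]
      refine Submodule.smul_mem _ _ ?_
      rw [MvPolynomial.mem_weightedHomogeneousSubmodule]
      have h1 := (isWeightedHomogeneous_xvar (n + 1 - i)).mul (ih i i.isLt)
      rwa [Nat.sub_add_cancel i.isLt.le] at h1

theorem isWeightedHomogeneous_prod_h (M : ℕ) (m : Multiset ℕ) :
    MvPolynomial.IsWeightedHomogeneous (fun n : ℕ+ => (n : ℕ)) (m.map (h M)).prod m.sum := by
  induction m using Multiset.induction_on with
  | empty => exact MvPolynomial.isWeightedHomogeneous_one ℂ _
  | cons k m ih =>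
    rw [Multiset.map_cons, Multiset.prod_cons, Multiset.sum_cons]
    exact (isWeightedHomogeneous_h M k).mul ih

/-- The operator `∑_{n>0} a_{-n} a_n`. -/
def energy (M : ℕ) : Module.End ℂ LatticeSpace :=
  locallyFiniteSum (fun k => a M (-((k : ℤ) + 1)) * a M ((k : ℤ) + 1)) (a_mul_a_finite M)

/-- Each a_{-n} a_n is n times the Euler operator of x_n; summed over n these measure the weighted
degree. -/
theorem xvar_mul_dvar_monomial (k : ℕ) (s : ℕ+ →₀ ℕ) (c : ℂ) :
    xvar (k + 1) * dvar (k + 1) (MvPolynomial.monomial s c) =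
      ((k.succPNat : ℕ) * s k.succPNat : ℕ) • MvPolynomial.monomial s c := by
  rw [xvar, dvar, LinearMap.smul_apply]
  change _ * ((k : ℂ) + 1) • MvPolynomial.pderiv k.succPNat (MvPolynomial.monomial s c) = _
  rw [mul_smul_comm, MvPolynomial.X_mul_pderiv_monomial, mul_smul,
    ← Nat.cast_smul_eq_nsmul ℂ (k.succPNat : ℕ), Nat.succPNat_coe, Nat.cast_succ]

theorem energy_single_monomial (M : ℕ) (m : ℤ) (s : ℕ+ →₀ ℕ) (c : ℂ) :
    energy M (Finsupp.single m (MvPolynomial.monomial s c)) =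
      (Finsupp.weight (fun n : ℕ+ => (n : ℕ)) s : ℂ) •
        Finsupp.single m (MvPolynomial.monomial s c) := by
  change (∑ᶠ k : ℕ, (a M (-((k : ℤ) + 1)) * a M ((k : ℤ) + 1))
    (Finsupp.single m (MvPolynomial.monomial s c))) = _
  let G : ℕ+ → LatticeSpace := fun n =>
    ((n : ℕ) * s n) • Finsupp.single m (MvPolynomial.monomial s c)
  have hterm : ∀ k : ℕ, (a M (-((k : ℤ) + 1)) * a M ((k : ℤ) + 1))
      (Finsupp.single m (MvPolynomial.monomial s c)) = G (Equiv.pnatEquivNat.symm k) := by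
    intro k
    have h1 := a_neg M k.succ_ne_zero
    have h2 := a_pos M k.succ_ne_zero
    push_cast at h1 h2
    rw [Module.End.mul_apply, h1, h2, summandwise_single, summandwise_single]
    exact (congrArg (Finsupp.single m) (xvar_mul_dvar_monomial k s c)).trans
      (Finsupp.smul_single _ _ _).symm
  rw [finsum_congr hterm, finsum_comp_equiv Equiv.pnatEquivNat.symm (f := G),
    finsum_eq_sum_of_support_subset (s := s.support), ← Finset.sum_smul, Finsupp.weight_apply,
    Finsupp.sum, ← Nat.cast_smul_eq_nsmul ℂ]
  · simp [mul_comm]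
  · intro n hn
    rw [Finset.mem_coe, Finsupp.mem_support_iff]
    intro h0
    exact hn (by simp [G, h0])

theorem energy_single (M : ℕ) (m : ℤ) {P : MvPolynomial ℕ+ ℂ} {n : ℕ}
    (hP : MvPolynomial.IsWeightedHomogeneous (fun n : ℕ+ => (n : ℕ)) P n) :
    energy M (Finsupp.single m P) = (n : ℂ) • Finsupp.single m P := by
  have hsum : Finsupp.single m P = ∑ s ∈ P.support,
      Finsupp.single m (MvPolynomial.monomial s (MvPolynomial.coeff s P)) := by
    rw [← Finsupp.single_finsetSum, ← P.as_sum]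
  rw [hsum, map_sum, Finset.smul_sum]
  refine Finset.sum_congr rfl fun s hs => ?_
  rw [energy_single_monomial, hP (MvPolynomial.mem_support_iff.mp hs)]

theorem a_zero_hVec (M : ℕ) (j : ℤ) (x : Multiset ℕ) :
    a M 0 (hVec M j x) = (((j + x.card : ℤ) : ℂ) * root M) • hVec M j x := by
  rw [hVec, a_zero_single, Finsupp.smul_single]

theorem L0_hVec (M : ℕ) (lam : ℂ) (j : ℤ) (x : Multiset ℕ) :
    L0 M lam (hVec M j x) = ((1 / 2) * (((j + x.card : ℤ) : ℂ) * root M) ^ 2 -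
      lam * (((j + x.card : ℤ) : ℂ) * root M) + x.sum) • hVec M j x := by
  change (1 / 2 : ℂ) • a M 0 (a M 0 (hVec M j x)) + energy M (hVec M j x) -
    lam • a M 0 (hVec M j x) = _
  have he : energy M (hVec M j x) = (x.sum : ℂ) • hVec M j x :=
    energy_single M _ (isWeightedHomogeneous_prod_h M x)
  rw [he, a_zero_hVec, map_smul, a_zero_hVec]
  module

/-- Applying T - c to an expansion in independent eigenvectors kills every coefficient whose
eigenvalue is not c. Used once for a_0 and once for L_0. -/
theorem span_image_inf_eigenspace {I V : Type*} [AddCommGroup V] [Module ℂ V] {B : I → V}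
    (hB : LinearIndependent ℂ B) (T : Module.End ℂ V) {μ : I → ℂ} (hT : ∀ i, T (B i) = μ i • B i)
    (S : Set I) (c : ℂ) :
    Submodule.span ℂ (B '' S) ⊓ Module.End.eigenspace T c =
      Submodule.span ℂ (B '' {i ∈ S | μ i = c}) := by
  apply le_antisymm
  · rintro x ⟨hx, hc⟩
    obtain ⟨l, hl, rfl⟩ := (Finsupp.mem_span_image_iff_linearCombination ℂ).mp hx
    rw [SetLike.mem_coe, Module.End.mem_eigenspace_iff, Finsupp.linearCombination_apply,
      Finsupp.sum, map_sum, Finset.smul_sum, ← sub_eq_zero, ← Finset.sum_sub_distrib] at hc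
    have h0 : ∑ i ∈ l.support, (l i * (μ i - c)) • B i = 0 := by
      rw [← hc]
      refine Finset.sum_congr rfl fun i _ => ?_
      rw [map_smul, hT]
      module
    have h1 := linearIndependent_iff'.mp hB _ _ h0
    refine (Finsupp.mem_span_image_iff_linearCombination ℂ).mpr ⟨l, ?_, rfl⟩
    rw [Finsupp.mem_supported] at hl ⊢
    intro i hi
    refine ⟨hl hi, ?_⟩
    have := h1 i hi
    rw [mul_eq_zero, sub_eq_zero] at this
    exact this.resolve_left (Finsupp.mem_support_iff.mp hi)
  · refine Submodule.span_le.mpr ?_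
    rintro _ ⟨i, ⟨hi, rfl⟩, rfl⟩
    exact ⟨Submodule.subset_span ⟨i, hi, rfl⟩, Module.End.mem_eigenspace_iff.mpr (hT i)⟩

/-! ### Counting multisets and the character -/

/-- The multisets of `k` natural numbers with sum `n`. -/
def multisetsWith (k n : ℕ) : Set (Multiset ℕ) := {x | x.card = k ∧ x.sum = n}

theorem sum_map_succ (x : Multiset ℕ) : (x.map Nat.succ).sum = x.sum + x.card := by
  induction x using Multiset.induction_on with
  | empty => simp
  | cons a x ih => simp [ih]; omega

/-- Either 0 occurs and one copy is removed, or all k + 1 entries are positive and each is lowered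
by 1. This is the recursion expressed by division by 1 - q^{k+1}. -/
theorem multisetsWith_succ (k n : ℕ) : multisetsWith (k + 1) n =
    (fun x => (0 : ℕ) ::ₘ x) '' multisetsWith k n ∪ Multiset.map Nat.succ ''
      (if k + 1 ≤ n then multisetsWith (k + 1) (n - (k + 1)) else ∅) := by
  apply subset_antisymm
  · rintro x ⟨hc, hs⟩
    by_cases h0 : 0 ∈ x
    · obtain ⟨y, rfl⟩ := Multiset.exists_cons_of_mem h0
      rw [Multiset.card_cons] at hc
      rw [Multiset.sum_cons, zero_add] at hs
      exact Or.inl ⟨y, ⟨by omega, hs⟩, rfl⟩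
    · right
      have hx : (x.map Nat.pred).map Nat.succ = x := by
        rw [Multiset.map_map]
        refine (Multiset.map_congr rfl fun a ha => ?_).trans x.map_id
        exact Nat.succ_pred_eq_of_ne_zero fun e => h0 (e ▸ ha)
      have h1 := sum_map_succ (x.map Nat.pred)
      rw [hx, Multiset.card_map, hs, hc] at h1
      refine ⟨x.map Nat.pred, ?_, hx⟩
      rw [if_pos (by omega)]
      exact ⟨by rw [Multiset.card_map, hc], by omega⟩
  · rintro x (⟨y, ⟨hc, hs⟩, rfl⟩ | ⟨y, hy, rfl⟩)
    · exact ⟨by simp [hc], by simp [hs]⟩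
    · split_ifs at hy with hn
      · exact ⟨by rw [Multiset.card_map, hy.1], by rw [sum_map_succ, hy.1, hy.2]; omega⟩
      · exact hy.elim

theorem multisetsWith_zero (n : ℕ) : multisetsWith 0 n = if n = 0 then {0} else ∅ := by
  ext x
  split_ifs with hn
  · simp only [multisetsWith, Set.mem_ofPred_eq, Multiset.card_eq_zero, Set.mem_singleton_iff]
    exact ⟨fun hx => hx.1, fun hx => ⟨hx, by simp [hx, hn]⟩⟩
  · simp only [multisetsWith, Set.mem_ofPred_eq, Multiset.card_eq_zero, Set.mem_empty_iff_false,
      iff_false]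
    rintro ⟨rfl, rfl⟩
    simp at hn

theorem finite_multisetsWith (k n : ℕ) : (multisetsWith k n).Finite := by
  induction k generalizing n with
  | zero =>
    rw [multisetsWith_zero]
    split_ifs
    · exact Set.finite_singleton _
    · exact Set.finite_empty
  | succ k ihk =>
    induction n using Nat.strong_induction_on with
    | _ n ihn =>
      rw [multisetsWith_succ]
      refine ((ihk n).image _).union (Set.Finite.image _ ?_)
      split_ifs with hn
      · exact ihn _ (by omega)
      · exact Set.finite_empty

theorem ncard_multisetsWith_succ (k n : ℕ) : (multisetsWith (k + 1) n).ncard =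
    (multisetsWith k n).ncard +
      if k + 1 ≤ n then (multisetsWith (k + 1) (n - (k + 1))).ncard else 0 := by
  have hfin : (if k + 1 ≤ n then multisetsWith (k + 1) (n - (k + 1)) else ∅).Finite := by
    split_ifs
    · exact finite_multisetsWith _ _
    · exact Set.finite_empty
  rw [multisetsWith_succ, Set.ncard_union_eq ?_ ((finite_multisetsWith k n).image _)
    (hfin.image _)]
  · rw [Set.ncard_image_of_injective _ fun _ _ e => (Multiset.cons_inj_right 0).mp e,
      Set.ncard_image_of_injective _ (Multiset.map_injective Nat.succ_injective)]
    split_ifs <;> simp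
  · rw [Set.disjoint_left]
    rintro _ ⟨y, _, rfl⟩ ⟨z, _, hz⟩
    have h0 : 0 ∈ z.map Nat.succ := by rw [hz]; exact Multiset.mem_cons_self 0 y
    obtain ⟨a, _, ha⟩ := Multiset.mem_map.mp h0
    exact Nat.succ_ne_zero a ha

theorem constantCoeff_qPoch (k : ℕ) : PowerSeries.constantCoeff (qPoch k) = 1 := by
  rw [qPoch, map_prod]
  refine Finset.prod_eq_one fun i _ => ?_
  simp

theorem coeff_inv_qPoch (k n : ℕ) :
    PowerSeries.coeff n (qPoch k)⁻¹ = ((multisetsWith k n).ncard : ℚ) := by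
  have key : ∀ k, (PowerSeries.mk fun n => ((multisetsWith k n).ncard : ℚ)) * qPoch k = 1 := by
    intro k
    induction k with
    | zero =>
      rw [qPoch, Finset.prod_range_zero, mul_one]
      ext1 n
      rw [PowerSeries.coeff_mk, PowerSeries.coeff_one, multisetsWith_zero]
      split_ifs <;> simp
    | succ k ih =>
      rw [qPoch, Finset.prod_range_succ, ← qPoch, mul_comm (qPoch k), ← mul_assoc]
      suffices hs : (PowerSeries.mk fun n => ((multisetsWith (k + 1) n).ncard : ℚ)) *
          (1 - PowerSeries.X ^ (k + 1)) =
          PowerSeries.mk fun n => ((multisetsWith k n).ncard : ℚ) by rw [hs, ih]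
      ext1 n
      rw [mul_sub, mul_one, map_sub, PowerSeries.coeff_mul_X_pow', PowerSeries.coeff_mk,
        PowerSeries.coeff_mk, ncard_multisetsWith_succ]
      split_ifs <;> simp
  have h1 := (PowerSeries.eq_inv_iff_mul_eq_one
    (by rw [constantCoeff_qPoch]; exact one_ne_zero)).mpr (key k)
  rw [← h1, PowerSeries.coeff_mk]

/-- The joint eigenspace for (m, d) has as basis the products over multisets with m - j elements and
sum d - E(m), where E(m) is the L_0-eigenvalue of |m√M⟩. -/
theorem hasCharacter_span_hVec {M : ℕ} (hM : 0 < M) (lam : ℂ) (j : ℤ) (E : ℤ → ℕ)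
    (hE : ∀ m : ℤ, (E m : ℂ) = (1 / 2) * ((m : ℂ) * root M) ^ 2 - lam * ((m : ℂ) * root M)) :
    HasCharacter M lam (Submodule.span ℂ (Set.range (hVec M j))) fun m =>
      if j ≤ m then PowerSeries.X ^ E m * (qPoch (m - j).toNat)⁻¹ else 0 := by
  have hL : ∀ x : Multiset ℕ, L0 M lam (hVec M j x) =
      ((E (j + x.card) + x.sum : ℕ) : ℂ) • hVec M j x := by
    intro x
    rw [L0_hVec, Nat.cast_add, hE]
  have hind := linearIndependent_hVec hM j
  refine ⟨le_antisymm (Submodule.span_le.mpr ?_)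
    (iSup_le fun m => iSup_le fun d => inf_le_left), fun m d => ?_⟩
  · rintro _ ⟨x, rfl⟩
    refine Submodule.mem_iSup_of_mem (j + x.card : ℤ)
      (Submodule.mem_iSup_of_mem (E (j + x.card) + x.sum) ⟨Submodule.subset_span ⟨x, rfl⟩, ?_, ?_⟩)
    · exact Module.End.mem_eigenspace_iff.mpr (a_zero_hVec M j x)
    · exact Module.End.mem_eigenspace_iff.mpr (hL x)
  · set S : Set (Multiset ℕ) := {x | j + x.card = m ∧ E m + x.sum = d} with hS
    have hspan : Submodule.span ℂ (Set.range (hVec M j)) ⊓ bidegree M lam m d =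
        Submodule.span ℂ (Set.range fun x : S => hVec M j x) := by
      rw [bidegree, ← inf_assoc, ← Set.image_univ,
        span_image_inf_eigenspace hind _ (a_zero_hVec M j),
        span_image_inf_eigenspace hind _ hL]
      -- As √M ≠ 0, the a_0-eigenvalue fixes the number of factors, and E may then be evaluated at
      -- m.
      have hset : {x ∈ {x ∈ (Set.univ : Set (Multiset ℕ)) |
          ((j + x.card : ℤ) : ℂ) * root M = (m : ℂ) * root M} |
            ((E (j + x.card) + x.sum : ℕ) : ℂ) = (d : ℂ)} = S := by
        ext x
        simp only [hS, Set.mem_ofPred_eq, Set.mem_univ, true_and, Nat.cast_inj,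
          mul_left_inj' (root_ne_zero hM), Int.cast_inj]
        exact and_congr_right fun e => by rw [e]
      rw [hset]
      congr 1
      ext v
      simp
    have hSeq : S = if j ≤ m ∧ E m ≤ d then multisetsWith (m - j).toNat (d - E m) else ∅ := by
      ext x
      split_ifs with hjm
      · simp only [hS, multisetsWith, Set.mem_ofPred_eq]
        omega
      · exact iff_of_false (fun hx => hjm ⟨by have := hx.1; omega, by have := hx.2; omega⟩)
          (Set.notMem_empty x)
    have hfin : S.Finite := by
      rw [hSeq]
      split_ifs
      · exact finite_multisetsWith _ _
      · exact Set.finite_empty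
    have := hfin.fintype
    rw [hspan]
    refine ⟨FiniteDimensional.span_of_finite ℂ (Set.finite_range _), ?_⟩
    rw [finrank_span_eq_card (b := fun x : S => hVec M j x)
      (hind.comp _ Subtype.val_injective), ← Nat.card_eq_fintype_card,
      Nat.card_coe_set_eq, hSeq]
    beta_reduce
    by_cases hjm : j ≤ m
    · rw [if_pos hjm, PowerSeries.coeff_X_pow_mul', coeff_inv_qPoch]
      simp only [hjm, true_and]
      split_ifs <;> simp
    · simp [hjm]

/-! ### The isomorphisms with Fibonacci polynomials -/

/-- Independence of the images under G forces independence of the abstract monomials, so G matches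
one basis with another. This treats commuting and anticommuting variables alike. -/
theorem exists_linearEquiv_basicSubspace {X : Type*} [AddCommMonoid X] [Module ℂ X]
    {M l : ℕ} (hM : 0 < M) (hl : M - 1 = l) {κ j b : ℤ} (hb : b = -κ - M * j) (G : X →ₗ[ℂ] LatticeSpace)
    (mon : Finset ℤ → X) (hG : ∀ s, G (mon s) = fibVec M κ j s) :
    ∃ ψ : ↥(Submodule.span ℂ {f | ∃ s, IsFib l b s ∧ f = mon s}) ≃ₗ[ℂ]
        ↥(basicSubspace (fun n => vertexCoeff M (-n - κ)) j),
      ∀ f, (ψ f : LatticeSpace) = G f := by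
  subst hb hl
  have hrange : {f | ∃ s, IsFib (M - 1) (-κ - M * j) s ∧ f = mon s} =
      Set.range fun s : {s // IsFib (M - 1) (-κ - M * j) s} => mon s := by
    ext f
    simp [eq_comm]
  have hfib := linearIndependent_fibVec hM κ j
  have hmon : LinearIndependent ℂ fun s : {s // IsFib (M - 1) (-κ - M * j) s} => mon s := by
    refine LinearIndependent.of_comp G ?_
    have : (G ∘ fun s : {s // IsFib (M - 1) (-κ - M * j) s} => mon s) =
        fun s : {s // IsFib (M - 1) (-κ - M * j) s} => fibVec M κ j s := funext fun s => hG s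
    rwa [this]
  rw [hrange, ← span_fibVec hM κ j]
  let b₁ := Module.Basis.span hmon
  let b₂ := Module.Basis.span hfib
  refine ⟨b₁.equiv b₂ (Equiv.refl _), fun f => ?_⟩
  have : (Submodule.subtype _) ∘ₗ (b₁.equiv b₂ (Equiv.refl _)).toLinearMap =
      G ∘ₗ Submodule.subtype _ := by
    refine b₁.ext fun s => ?_
    have h1 : (b₁ s : X) = mon s :=
      congrArg Subtype.val (Module.Basis.span_apply hmon s)
    have h2 : (b₂ s : LatticeSpace) = fibVec M κ j s :=
      congrArg Subtype.val (Module.Basis.span_apply hfib s)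
    simp only [LinearMap.comp_apply, LinearEquiv.coe_coe, Module.Basis.equiv_apply,
      Equiv.refl_apply, Submodule.subtype_apply]
    rw [h1, h2, hG]
  exact LinearMap.congr_fun this f

theorem exists_linearEquiv_of_algHom {B : Type*} [Semiring B] [Algebra ℂ B] {M l : ℕ} (hM : 0 < M)
    (hl : M - 1 = l) {κ j b : ℤ} (hb : b = -κ - M * j) (Φ : B →ₐ[ℂ] Module.End ℂ LatticeSpace)
    (mon : Finset ℤ → B) (hΦ : ∀ s, Φ (mon s) (vac j) = fibVec M κ j s) :
    ∃ ψ : ↥(Submodule.span ℂ {f | ∃ s, IsFib l b s ∧ f = mon s}) ≃ₗ[ℂ]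
        ↥(basicSubspace (fun n => vertexCoeff M (-n - κ)) j),
      ∀ f, (ψ f : LatticeSpace) = Φ f (vac j) :=
  exists_linearEquiv_basicSubspace hM hl hb
    ((LinearMap.applyₗ (vac j)).comp Φ.toLinearMap) mon hΦ

/-- The monomial with index set `s` in the anticommuting variables. -/
def antiMonomial (s : Finset ℤ) : AntiPoly := (s.sort.map antiX).prod

theorem fibAntiPoly_eq (l : ℕ) (b : ℤ) : fibAntiPoly l b =
    Submodule.span ℂ {f | ∃ s, IsFib l b s ∧ f = antiMonomial s} := rfl

theorem e_commute (N : ℕ) (i k : ℤ) : e N i * e N k = e N k * e N i := by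
  rw [e, e, vertexCoeff_mul_vertexCoeff, pow_mul, neg_one_sq, one_pow, one_smul]

theorem θ_anticommute (N : ℕ) (i k : ℤ) : θ N i * θ N k = (-1 : ℂ) • (θ N k * θ N i) := by
  rw [θ, θ, vertexCoeff_mul_vertexCoeff, pow_succ, pow_mul, neg_one_sq, one_pow, one_mul]

open scoped IsMulCommutative in
/-- The polynomial algebra acts through commuting elements. -/
theorem exists_algHom_of_commute {A : Type*} [Ring A] [Algebra ℂ A] (f : ℤ → A)
    (hf : ∀ i k, f i * f k = f k * f i) :
    ∃ Φ : MvPolynomial ℤ ℂ →ₐ[ℂ] A, ∀ i : ℤ, Φ (MvPolynomial.X i) = f i := by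
  have : IsMulCommutative (Algebra.adjoin ℂ (Set.range f)) :=
    Algebra.isMulCommutative_adjoin ℂ (by
      rintro _ ⟨i, rfl⟩ _ ⟨k, rfl⟩
      exact hf i k)
  refine ⟨(Algebra.adjoin ℂ (Set.range f)).val.comp (MvPolynomial.aeval fun i =>
    ⟨f i, Algebra.subset_adjoin ⟨i, rfl⟩⟩), fun i => ?_⟩
  rw [AlgHom.comp_apply, MvPolynomial.aeval_X]
  rfl

/-- Squares of all linear combinations must vanish for the universal property of the exterior
algebra. Interchanging the two summation indices shows that the square equals its own negative. -/
theorem linearCombination_sq {A : Type*} [Ring A] [Algebra ℂ A] (f : ℤ → A)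
    (hf : ∀ i k, f i * f k = (-1 : ℂ) • (f k * f i)) (l : ℤ →₀ ℂ) :
    Finsupp.linearCombination ℂ f l * Finsupp.linearCombination ℂ f l = 0 := by
  set x := Finsupp.linearCombination ℂ f l * Finsupp.linearCombination ℂ f l with hx
  have h1 : x = ∑ i ∈ l.support, ∑ k ∈ l.support, (l i * l k) • (f i * f k) := by
    rw [hx, Finsupp.linearCombination_apply, Finsupp.sum, Finset.sum_mul_sum]
    refine Finset.sum_congr rfl fun i _ => Finset.sum_congr rfl fun k _ => ?_
    rw [smul_mul_smul_comm]
  have h2 : x = -x := by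
    conv_lhs => rw [h1, Finset.sum_comm]
    rw [h1]
    simp only [← Finset.sum_neg_distrib]
    refine Finset.sum_congr rfl fun i _ => Finset.sum_congr rfl fun k _ => ?_
    rw [hf, mul_comm (l k)]
    module
  refine nsmul_cancel two_ne_zero ?_
  rw [smul_zero, two_nsmul]
  exact add_eq_zero_iff_eq_neg.mpr h2

/-- The exterior algebra acts through anticommuting elements. -/
theorem exists_algHom_of_anticommute {A : Type*} [Ring A] [Algebra ℂ A] (f : ℤ → A)
    (hf : ∀ i k, f i * f k = (-1 : ℂ) • (f k * f i)) :
    ∃ Φ : AntiPoly →ₐ[ℂ] A, ∀ i : ℤ, Φ (antiX i) = f i := by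
  refine ⟨ExteriorAlgebra.lift ℂ ⟨Finsupp.linearCombination ℂ f, linearCombination_sq f hf⟩,
    fun i => ?_⟩
  rw [antiX, ExteriorAlgebra.lift_ι_apply, Finsupp.linearCombination_single, one_smul]

theorem algHom_prod_eq_sort {A B : Type*} [CommSemiring B] [Algebra ℂ B] [Semiring A]
    [Algebra ℂ A] (Φ : B →ₐ[ℂ] A) (s : Finset ℤ) (f : ℤ → B) :
    Φ (∏ i ∈ s, f i) = (s.sort.map fun i => Φ (f i)).prod := by
  rw [Finset.prod, ← Finset.sort_eq s (· ≤ ·), Multiset.map_coe, Multiset.prod_coe,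
    map_list_prod, List.map_map]
  rfl

theorem algHom_list_prod {A B : Type*} [Semiring B] [Algebra ℂ B] [Semiring A]
    [Algebra ℂ A] (Φ : B →ₐ[ℂ] A) (l : List ℤ) (f : ℤ → B) :
    Φ (l.map f).prod = (l.map fun i => Φ (f i)).prod := by
  rw [map_list_prod, List.map_map]
  rfl

theorem Weven_eq (N : ℕ) (j : ℤ) :
    Weven N j = basicSubspace (fun n => vertexCoeff (2 * N) (-n - N)) j := rfl

theorem Wodd_eq (N : ℕ) (j : ℤ) :
    Wodd N j = basicSubspace (fun n => vertexCoeff (2 * N + 1) (-n - 0)) j := by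
  simp only [sub_zero]
  rfl

theorem hasCharacter_Weven {N : ℕ} (hN : 0 < N) (j : ℤ) :
    HasCharacter (2 * N) 0 (Weven N j) (chEven N j) := by
  rw [Weven_eq, basicSubspace_eq (by omega)]
  refine hasCharacter_span_hVec (by omega) 0 j (fun m => N * m.natAbs ^ 2) fun m => ?_
  have h1 : ((m.natAbs : ℂ)) ^ 2 = (m : ℂ) ^ 2 := by
    have := congrArg (Int.cast : ℤ → ℂ) (Int.natAbs_sq m)
    push_cast at this
    rw [Nat.cast_natAbs]
    exact this
  push_cast
  rw [h1, mul_pow, pow_two (root _), root_mul_root]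
  push_cast
  ring

theorem hasCharacter_Wodd (N : ℕ) (j : ℤ) :
    HasCharacter (2 * N + 1) (root (2 * N + 1) / 2) (Wodd N j) (chOdd N j) := by
  rw [Wodd_eq, basicSubspace_eq (by omega)]
  refine hasCharacter_span_hVec (by omega) _ j (fun m => (2 * N + 1) * (m * (m - 1) / 2).toNat)
    fun m => ?_
  have h0 : 0 ≤ m * (m - 1) / 2 := by
    refine Int.ediv_nonneg ?_ (by norm_num)
    rcases le_or_gt m 0 with hm | hm <;> nlinarith
  have h1 : (((m * (m - 1) / 2).toNat : ℕ) : ℂ) * 2 = m * (m - 1) := by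
    have h2 : ((m * (m - 1) / 2).toNat : ℤ) * 2 = m * (m - 1) := by
      rw [Int.toNat_of_nonneg h0]
      refine Int.ediv_mul_cancel ?_
      have := (Int.even_mul_pred_self m).two_dvd
      exact this
    exact_mod_cast congrArg (Int.cast : ℤ → ℂ) h2
  have h3 := root_mul_root (2 * N + 1)
  push_cast at h3 ⊢
  linear_combination ((2 * N + 1) / 2 : ℂ) * h1 - (m ^ 2 / 2 - m / 2 : ℂ) * h3

end LatticeVOA
end

theorem mainTheorem4 :
    (∀ N : ℕ, 0 < N →
      ∃ Φ : MvPolynomial ℤ ℂ →ₐ[ℂ] Module.End ℂ LatticeSpace,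
        (∀ i : ℤ, Φ (MvPolynomial.X i) = LatticeVOA.e N i) ∧
        ∀ j : ℤ,
          (∃ ψ : ↥(LatticeVOA.fibPoly (2 * N - 1) (-2 * N * j - N)) ≃ₗ[ℂ]
              ↥(LatticeVOA.Weven N j),
            ∀ f, (ψ f : LatticeSpace) = Φ f (LatticeVOA.vac j)) ∧
          LatticeVOA.HasCharacter (2 * N) 0 (LatticeVOA.Weven N j) (LatticeVOA.chEven N j)) ∧
    (∀ N : ℕ,
      ∃ Φ : LatticeVOA.AntiPoly →ₐ[ℂ] Module.End ℂ LatticeSpace,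
        (∀ i : ℤ, Φ (LatticeVOA.antiX i) = LatticeVOA.θ N i) ∧
        ∀ j : ℤ,
          (∃ ψ : ↥(LatticeVOA.fibAntiPoly (2 * N) (-j * (2 * N + 1))) ≃ₗ[ℂ]
              ↥(LatticeVOA.Wodd N j),
            ∀ f, (ψ f : LatticeSpace) = Φ f (LatticeVOA.vac j)) ∧
          LatticeVOA.HasCharacter (2 * N + 1) (LatticeVOA.root (2 * N + 1) / 2)
            (LatticeVOA.Wodd N j) (LatticeVOA.chOdd N j)) := by
  refine ⟨fun N hN => ?_, fun N => ?_⟩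
  · obtain ⟨Φ, hΦ⟩ := LatticeVOA.exists_algHom_of_commute
      (A := Module.End ℂ LatticeSpace) _ (LatticeVOA.e_commute N)
    refine ⟨Φ, hΦ, fun j => ⟨?_, LatticeVOA.hasCharacter_Weven hN j⟩⟩
    rw [LatticeVOA.Weven_eq]
    refine LatticeVOA.exists_linearEquiv_of_algHom (M := 2 * N) (κ := N) (by omega) rfl
      (by push_cast; ring) Φ (fun s => ∏ i ∈ s, MvPolynomial.X i) fun s => ?_
    rw [LatticeVOA.fibVec, LatticeVOA.algHom_prod_eq_sort]
    simp only [hΦ]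
    rfl
  · obtain ⟨Φ, hΦ⟩ := LatticeVOA.exists_algHom_of_anticommute
      (A := Module.End ℂ LatticeSpace) _ (LatticeVOA.θ_anticommute N)
    refine ⟨Φ, hΦ, fun j => ⟨?_, LatticeVOA.hasCharacter_Wodd N j⟩⟩
    rw [LatticeVOA.Wodd_eq, LatticeVOA.fibAntiPoly_eq]
    refine LatticeVOA.exists_linearEquiv_of_algHom (M := 2 * N + 1) (κ := 0) (by omega) rfl
      (by push_cast; ring) Φ LatticeVOA.antiMonomial fun s => ?_
    rw [LatticeVOA.fibVec, LatticeVOA.antiMonomial, LatticeVOA.algHom_list_prod]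
    simp only [hΦ, sub_zero]
    rfl
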